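/- Let $A$ be a finite alphabet. A \emph{ranker} is a non-empty word over $\{X_a, Y_a \mid a\in A\}$. For $u\in A^*$, with positions numbered $1,\dots,|u|$, and an integer $q$, let $X_a(u,q)$ be the least $a$-position of $u$ greater than $q$, and $Y_a(u,q)$ the greatest $a$-position of $u$ less than $q$, if it exists. For a ranker $r=Z_1\cdots Z_n$ define $r(u,q)$ by executing $Z_1,\dots,Z_n$ successively from $q$, and let $r(u)=r(u,0)$ if $Z_1$ is an $X$-letter, $r(u)=r(u,|u|+1)$ if $Z_1$ is a $Y$-letter. The ranker $r$ is \emph{condensed} on $u$ if $r(u)$ is defined and there is a strictly decreasing chain of open intervals of positions $(0,|u|+1)=(i_0,j_0)\supset(i_1,j_1)\supset\cdots\supset(i_{n-1},j_{n-1})\ni r(u)$ such that for $1\le\ell\le n-1$: $(i_\ell,j_\ell)=(X_a(u,i_{\ell-1}),j_{\ell-1})$ if $Z_\ell Z_{\ell+1}=X_aX_b$; $(i_{\ell-1},Y_a(u,j_{\ell-1}))$ if $Z_\ell Z_{\ell+1}=Y_aY_b$; $(i_{\ell-1},X_a(u,i_{\ell-1}))$ if $Z_\ell Z_{\ell+1}=X_aY_b$;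 $(Y_a(u,j_{\ell-1}),j_{\ell-1})$ if $Z_\ell Z_{\ell+1}=Y_aX_b$. The depth of a ranker is its length; its blocks are its maximal factors consisting only of $X$-letters or only of $Y$-letters. For $n\ge m\ge 1$ write $u\mathrel{\triangleright}_{m,n}v$ (resp. $u\mathrel{\triangleleft}_{m,n}v$) if the same rankers are condensed on $u$ and on $v$ among those which either have exactly $m$ blocks, depth at most $n$, and start with an $X$-letter (resp. a $Y$-letter), or have fewer than $m$ blocks and depth less than $n$. These are finite-index congruences on $A^*$. Let $\mathbf R_m$ (resp. $\mathbf L_m$) be the pseudovariety of monoids (class of finite monoids closed under finite direct products, homomorphic images and submonoids) generated by the quotients $A^*/{\triangleright_{m,n}}$ (resp. $A^*/{\triangleleft_{m,n}}$), for $n\ge m$ and $A$ a finite alphabet. Let $\mathcal R_m$ and $\mathcal L_m$ be the corresponding varieties of languages: $\mathcal R_m(A)$ (resp. $\mathcal L_m(A)$) is the set of languages $L\subseteq A^*$ such that $L=\varphi^{-1}(\varphi(L))$ for some morphism $\varphi$ from $A^*$ to a monoid in $\mathbf R_m$ (resp. $\mathbf L_m$). A product $L=L_0a_1L_1\cdots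 a_kL_k$ ($k\ge1$, $a_i\in A$, $L_i\subseteq A^*$) is \emph{deterministic} (resp. \emph{co-deterministic}) if for each $1\le i\le k$ every word of $L$ has a unique prefix in $L_0a_1L_1\cdots L_{i-1}a_i$ (resp. a unique suffix in $a_iL_i\cdots a_kL_k$); it is \emph{visibly deterministic} (resp. \emph{visibly co-deterministic}) if for each $i$ the letter $a_i$ occurs in no word of $L_{i-1}$ (resp. of $L_i$). For a class of languages $\mathcal V=(\mathcal V(A))_A$, let $\mathcal V^{det}(A)$, $\mathcal V^{vdet}(A)$, $\mathcal V^{codet}(A)$, $\mathcal V^{vcodet}(A)$ be the sets of Boolean combinations of languages of $\mathcal V(A)$ and of, respectively, deterministic, visibly deterministic, co-deterministic, visibly co-deterministic products of languages of $\mathcal V(A)$. Let $\mathbf K$ (resp. $\mathbf D$) be the class of finite semigroups in which $x^\omega y=x^\omega$ (resp. $yx^\omega=x^\omega$) for all $x,y$, where $x^\omega$ is the idempotent power of $x$; let $\mathbf R$ (resp. $\mathbf L$) be the class of finite $\mathcal R$-trivial (resp. $\mathcal L$-trivial) monoids, in the sense of Green's relations. For a class $\mathbf V$ of finite semigroups and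 a class $\mathbf W$ of finite monoids, the Mal'cev product $\mathbf V\mathbin{\text{ⓜ}}\mathbf W$ is the class of finite monoids $M$ for which there are a finite monoid $T$ and onto morphisms $\alpha\colon T\to M$, $\beta\colon T\to N$ with $N\in\mathbf W$ and $\beta^{-1}(e)\in\mathbf V$ for each idempotent $e$ of $N$. \textbf{Proposition.} For each $m\ge1$, \[\mathcal R_{m+1}=\mathcal L_m^{vdet}=\mathcal L_m^{det},\qquad \mathbf R_{m+1}=\mathbf K\mathbin{\text{ⓜ}}\mathbf L_m,\qquad \mathcal L_{m+1}=\mathcal R_m^{vcodet}=\mathcal R_m^{codet},\qquad \mathbf L_{m+1}=\mathbf D\mathbin{\text{ⓜ}}\mathbf R_m .\] In particular, $\mathbf R_2=\mathbf R$ and $\mathbf L_2=\mathbf L$. -/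

import Mathlib

namespace RankerHierarchy

/-! ### Rankers -/

/-- The letters of rankers: `X a` reads "go to the next `a` to the right", `Y a` reads "go to the
next `a` to the left". -/
inductive RankerLetter (A : Type) : Type
  | X (a : A) : RankerLetter A
  | Y (a : A) : RankerLetter A

/-- `true` for the letters `X a`, `false` for the letters `Y a`. -/
def RankerLetter.isX {A : Type} : RankerLetter A → Bool
  | .X _ => true
  | .Y _ => false

/-- `HasLetterAt u p a`: the letter of `u` in position `p` is `a`; positions are numbered
`1, …, |u|`. -/
def HasLetterAt {A : Type} (u : List A) (p : ℕ) (a : A) : Prop :=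
  1 ≤ p ∧ u[p - 1]? = some a

/-- `X_a(u,q)` is defined and equal to `p`: the position `p` is the least `a`-position of `u`
which is greater than `q`. -/
def NextRight {A : Type} (u : List A) (a : A) (q p : ℕ) : Prop :=
  IsLeast {k | q < k ∧ HasLetterAt u k a} p

/-- `Y_a(u,q)` is defined and equal to `p`: the position `p` is the greatest `a`-position of `u`
which is less than `q`. -/
def NextLeft {A : Type} (u : List A) (a : A) (q p : ℕ) : Prop :=
  IsGreatest {k | k < q ∧ HasLetterAt u k a} p

/-- `Z(u,q)` is defined and equal to `p`, for a single letter `Z`. -/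
def RankerLetter.Goes {A : Type} (u : List A) : RankerLetter A → ℕ → ℕ → Prop
  | .X a => NextRight u a
  | .Y a => NextLeft u a

/-- `r(u,q)` is defined and equal to `p`: the instructions of `r` are executed one after the other,
starting from `q`. -/
def Goes {A : Type} (u : List A) : List (RankerLetter A) → ℕ → ℕ → Prop
  | [], q, p => q = p
  | Z :: r, q, p => ∃ q', Z.Goes u q q' ∧ Goes u r q' p

/-- `r(u)` is defined and equal to `p`: a ranker starting with an `X`-letter starts from position
`0`, a ranker starting with a `Y`-letter starts from position `|u| + 1`.  (Rankers are non-empty.) -/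
def DefinesPosition {A : Type} (r : List (RankerLetter A)) (u : List A) (p : ℕ) : Prop :=
  match r with
  | [] => False
  | .X a :: r' => Goes u (.X a :: r') 0 p
  | .Y a :: r' => Goes u (.Y a :: r') (u.length + 1) p

/-- How a condensed run passes from the open interval `(i, j)` to the next one `(i', j')`, when
`Z` is the current letter and `Z'` is the next one. -/
def NextInterval {A : Type} (u : List A) (Z Z' : RankerLetter A) (i j i' j' : ℕ) : Prop :=
  match Z, Z' with
  | .X a, .X _ => NextRight u a i i' ∧ j' = j
  | .Y a, .Y _ => i' = i ∧ NextLeft u a j j'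
  | .X a, .Y _ => i' = i ∧ NextRight u a i j'
  | .Y a, .X _ => NextLeft u a j i' ∧ j' = j

/-- The ranker `r = Z₁ ⋯ Zₙ` is condensed on `u`: it is defined on `u`, and there is a strictly
decreasing chain of open intervals of positions
`(0, |u| + 1) = (i₀, j₀) ⊃ (i₁, j₁) ⊃ ⋯ ⊃ (iₙ₋₁, jₙ₋₁) ∋ r(u)`, in which each interval is given by
the preceding one as in `NextInterval`.  In the list `r`, the letter `Z_ℓ` has index `ℓ - 1`. -/
def IsCondensedOn {A : Type} (r : List (RankerLetter A)) (u : List A) : Prop :=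
  ∃ (p : ℕ) (i j : ℕ → ℕ), DefinesPosition r u p ∧
    i 0 = 0 ∧ j 0 = u.length + 1 ∧
    (∀ ℓ, ∀ Z Z' : RankerLetter A, r[ℓ]? = some Z → r[ℓ + 1]? = some Z' →
      NextInterval u Z Z' (i ℓ) (j ℓ) (i (ℓ + 1)) (j (ℓ + 1)) ∧
      Set.Ioo (i (ℓ + 1)) (j (ℓ + 1)) ⊂ Set.Ioo (i ℓ) (j ℓ)) ∧
    p ∈ Set.Ioo (i (r.length - 1)) (j (r.length - 1))

/-- The number of blocks of a ranker (maximal factors consisting of `X`-letters only, or of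
`Y`-letters only). -/
def numBlocks {A : Type} : List (RankerLetter A) → ℕ
  | [] => 0
  | [_] => 1
  | Z :: Z' :: r => numBlocks (Z' :: r) + if Z.isX = Z'.isX then 0 else 1

/-- `R^X_{m,n}`: the `m`-block, depth `n` rankers starting with an `X`-letter. -/
def rankersX (A : Type) (m n : ℕ) : Set (List (RankerLetter A)) :=
  {r | numBlocks r = m ∧ r.length = n ∧ ∃ a r', r = .X a :: r'}

/-- `R^Y_{m,n}`: the `m`-block, depth `n` rankers starting with a `Y`-letter. -/
def rankersY (A : Type) (m n : ℕ) : Set (List (RankerLetter A)) :=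
  {r | numBlocks r = m ∧ r.length = n ∧ ∃ a r', r = .Y a :: r'}

/-- The underlined class `R^X_{m,n}`: all `m`-block rankers of depth at most `n` starting with an
`X`-letter, and all rankers with fewer than `m` blocks and depth less than `n`. -/
def rankersXle (A : Type) (m n : ℕ) : Set (List (RankerLetter A)) :=
  {r | (∃ n' ≤ n, r ∈ rankersX A m n') ∨
    ∃ m' < m, ∃ n' < n, r ∈ rankersX A m' n' ∪ rankersY A m' n'}

/-- The underlined class `R^Y_{m,n}`. -/
def rankersYle (A : Type) (m n : ℕ) : Set (List (RankerLetter A)) :=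
  {r | (∃ n' ≤ n, r ∈ rankersY A m n') ∨
    ∃ m' < m, ∃ n' < n, r ∈ rankersX A m' n' ∪ rankersY A m' n'}

/-- `u ▷_{m,n} v`: the same rankers of the underlined class `R^X_{m,n}` are condensed on `u` and
on `v`. -/
def EquivX {A : Type} (m n : ℕ) (u v : List A) : Prop :=
  ∀ r ∈ rankersXle A m n, IsCondensedOn r u ↔ IsCondensedOn r v

/-- `u ◁_{m,n} v`: the same rankers of the underlined class `R^Y_{m,n}` are condensed on `u` and
on `v`. -/
def EquivY {A : Type} (m n : ℕ) (u v : List A) : Prop :=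
  ∀ r ∈ rankersYle A m n, IsCondensedOn r u ↔ IsCondensedOn r v

/-! ### Pseudovarieties and varieties of languages -/

/-- Classes of monoids.  (Every finite monoid is isomorphic to one in `Type`.) -/
abbrev MonoidClass : Type 1 := (M : Type) → [Monoid M] → Prop

/-- Classes of semigroups. -/
abbrev SemigroupClass : Type 1 := (S : Type) → [Semigroup S] → Prop

/-- Pseudovarieties of monoids: classes of finite monoids closed under finite direct products,
homomorphic images and submonoids. -/
structure IsPseudovariety (V : MonoidClass) : Prop where
  finite : ∀ (M : Type) [Monoid M], V M → Finite M
  prod : ∀ (ι : Type) [Finite ι] (M : ι → Type) [∀ i, Monoid (M i)],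
    (∀ i, V (M i)) → V (∀ i, M i)
  image : ∀ (M N : Type) [Monoid M] [Monoid N] (f : M →* N),
    Function.Surjective f → V M → V N
  sub : ∀ (M : Type) [Monoid M] (S : Submonoid M), V M → V S

/-- The least pseudovariety containing a class `G` of finite monoids. -/
def generatedPseudovariety (G : MonoidClass) : MonoidClass := fun M _ =>
  ∀ V : MonoidClass, IsPseudovariety V → (∀ (N : Type) [Monoid N], G N → V N) → V M

/-- The pseudovariety `R_m`, generated by the quotients `A^* / ▷_{m,n}` for `n ≥ m` and `A` a finite
alphabet. -/
def pvR (m : ℕ) : MonoidClass :=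
  generatedPseudovariety fun M _ =>
    ∃ (A : Type) (_ : Finite A) (n : ℕ) (c : Con (FreeMonoid A)), m ≤ n ∧
      (∀ u v : FreeMonoid A, c u v ↔ EquivX m n u.toList v.toList) ∧ Nonempty (M ≃* c.Quotient)

/-- The pseudovariety `L_m`, generated by the quotients `A^* / ◁_{m,n}` for `n ≥ m` and `A` a finite
alphabet. -/
def pvL (m : ℕ) : MonoidClass :=
  generatedPseudovariety fun M _ =>
    ∃ (A : Type) (_ : Finite A) (n : ℕ) (c : Con (FreeMonoid A)), m ≤ n ∧
      (∀ u v : FreeMonoid A, c u v ↔ EquivY m n u.toList v.toList) ∧ Nonempty (M ≃* c.Quotient)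

/-- The language `L` is recognized by `M`: there is a morphism `φ : A^* → M` such that
`L = φ⁻¹(φ(L))`. -/
def RecognizedBy {A : Type} (L : Language A) (M : Type) [Monoid M] : Prop :=
  ∃ φ : FreeMonoid A →* M, ∀ w : List A,
    w ∈ L ↔ ∃ w' ∈ L, φ (FreeMonoid.ofList w) = φ (FreeMonoid.ofList w')

/-- Classes of languages: to each alphabet `A` (only finite ones matter) is associated a set of
languages in `A^*`. -/
abbrev LanguageClass : Type 1 := (A : Type) → Set (Language A)

/-- The class of languages corresponding to a class of monoids. -/
def languagesOf (V : MonoidClass) : LanguageClass := fun _ =>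
  {L | ∃ (M : Type) (_ : Monoid M), V M ∧ RecognizedBy L M}

/-- The variety of languages `𝓡_m`. -/
def langR (m : ℕ) : LanguageClass := languagesOf (pvR m)

/-- The variety of languages `𝓛_m`. -/
def langL (m : ℕ) : LanguageClass := languagesOf (pvL m)

/-! ### Deterministic and co-deterministic products

A product `L₀ a₁ L₁ ⋯ a_k L_k` is given by `L : ℕ → Language A` and `a : ℕ → A`, where the letter
`a_{i+1}` is `a i`; only `L 0, …, L k` and `a 0, …, a (k - 1)` matter. -/

/-- The language `L₀ a₁ L₁ ⋯ a_k L_k`. -/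
def markedProduct {A : Type} (L : ℕ → Language A) (a : ℕ → A) (k : ℕ) : Language A :=
  L 0 * ((List.range k).map fun i => ({[a i]} : Language A) * L (i + 1)).prod

/-- The language `L₀ a₁ L₁ ⋯ L_{i-1} a_i`. -/
def prefixProduct {A : Type} (L : ℕ → Language A) (a : ℕ → A) (i : ℕ) : Language A :=
  ((List.range i).map fun j => L j * ({[a j]} : Language A)).prod

/-- The language `a_{i+1} L_{i+1} ⋯ a_k L_k`. -/
def suffixProduct {A : Type} (L : ℕ → Language A) (a : ℕ → A) (k i : ℕ) : Language A :=
  ((List.range' i (k - i)).map fun j => ({[a j]} : Language A) * L (j + 1)).prod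

/-- The product `L₀ a₁ L₁ ⋯ a_k L_k` is deterministic. -/
def IsDet {A : Type} (L : ℕ → Language A) (a : ℕ → A) (k : ℕ) : Prop :=
  ∀ i ≤ k, ∀ u ∈ markedProduct L a k, ∃! p : List A, p <+: u ∧ p ∈ prefixProduct L a i

/-- The product `L₀ a₁ L₁ ⋯ a_k L_k` is visibly deterministic: `a_i` does not occur in `L_{i-1}`. -/
def IsVDet {A : Type} (L : ℕ → Language A) (a : ℕ → A) (k : ℕ) : Prop :=
  ∀ i < k, ∀ w ∈ L i, a i ∉ w

/-- The product `L₀ a₁ L₁ ⋯ a_k L_k` is co-deterministic. -/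
def IsCodet {A : Type} (L : ℕ → Language A) (a : ℕ → A) (k : ℕ) : Prop :=
  ∀ i ≤ k, ∀ u ∈ markedProduct L a k, ∃! s : List A, s <:+ u ∧ s ∈ suffixProduct L a k i

/-- The product `L₀ a₁ L₁ ⋯ a_k L_k` is visibly co-deterministic: `a_i` does not occur in `L_i`. -/
def IsVCodet {A : Type} (L : ℕ → Language A) (a : ℕ → A) (k : ℕ) : Prop :=
  ∀ i < k, ∀ w ∈ L (i + 1), a i ∉ w

/-- The Boolean combinations of languages of `V(A)` and of products `L₀ a₁ L₁ ⋯ a_k L_k` (`k ≥ 1`)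
of languages of `V(A)` which satisfy the condition `P`. -/
def productClosure (V : LanguageClass)
    (P : ∀ {A : Type}, (ℕ → Language A) → (ℕ → A) → ℕ → Prop) : LanguageClass := fun A =>
  (BooleanSubalgebra.closure
    (V A ∪ {K : Language A | ∃ (k : ℕ) (L : ℕ → Language A) (a : ℕ → A), 1 ≤ k ∧
      (∀ i ≤ k, L i ∈ V A) ∧ P L a k ∧ K = markedProduct L a k}) : Set (Language A))

/-- `V^det`. -/
def detClosure (V : LanguageClass) : LanguageClass := productClosure V IsDet

/-- `V^vdet`. -/
def vdetClosure (V : LanguageClass) : LanguageClass := productClosure V IsVDet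

/-- `V^codet`. -/
def codetClosure (V : LanguageClass) : LanguageClass := productClosure V IsCodet

/-- `V^vcodet`. -/
def vcodetClosure (V : LanguageClass) : LanguageClass := productClosure V IsVCodet

/-! ### The pseudovarieties `K`, `D`, `R`, `L` and Mal'cev products -/

/-- `e = x^ω`: `e` is an idempotent power of `x` (unique in a finite semigroup); the subsemigroup
generated by `x` consists of the powers `x, x², x³, …`. -/
def IsOmegaPower {S : Type} [Semigroup S] (x e : S) : Prop :=
  e ∈ Subsemigroup.closure {x} ∧ IsIdempotentElem e

/-- `K`: the finite semigroups satisfying `x^ω y = x^ω`. -/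
def pvK : SemigroupClass := fun S _ =>
  Finite S ∧ ∀ x y e : S, IsOmegaPower x e → e * y = e

/-- `D`: the finite semigroups satisfying `y x^ω = x^ω`. -/
def pvD : SemigroupClass := fun S _ =>
  Finite S ∧ ∀ x y e : S, IsOmegaPower x e → y * e = e

/-- The subsemigroup `β⁻¹(e)`, for `e` idempotent. -/
def idempotentFiber {T N : Type} [Monoid T] [Monoid N] (β : T →* N) (e : N)
    (he : IsIdempotentElem e) : Subsemigroup T where
  carrier := {t | β t = e}
  mul_mem' {s t} hs ht := by
    have hs' : β s = e := hs
    have ht' : β t = e := ht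
    change β (s * t) = e
    rw [map_mul, hs', ht']
    exact he

/-- The Mal'cev product of a class `V` of semigroups and a class `W` of monoids. -/
def malcev (V : SemigroupClass) (W : MonoidClass) : MonoidClass := fun M _ =>
  ∃ (T N : Type) (_ : Monoid T) (_ : Monoid N) (α : T →* M) (β : T →* N),
    Finite T ∧ Function.Surjective α ∧ Function.Surjective β ∧ W N ∧
    ∀ (e : N) (he : IsIdempotentElem e), V (idempotentFiber β e he)

/-- Green's relation `R`. -/
def GreenR {M : Type} [Monoid M] (s t : M) : Prop := (∃ v, s = t * v) ∧ ∃ v, t = s * v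

/-- Green's relation `L`. -/
def GreenL {M : Type} [Monoid M] (s t : M) : Prop := (∃ u, s = u * t) ∧ ∃ u, t = u * s

/-- The pseudovariety `R` of finite `R`-trivial monoids. -/
def pvRTrivial : MonoidClass := fun M _ => Finite M ∧ ∀ s t : M, GreenR s t → s = t

/-- The pseudovariety `L` of finite `L`-trivial monoids. -/
def pvLTrivial : MonoidClass := fun M _ => Finite M ∧ ∀ s t : M, GreenL s t → s = t

end RankerHierarchy

/-!
The proof rests on a recursive description of condensedness (`isCondensedOn_iff`): the ranker
`X_a r` is condensed on `u` when `u = p a s` with `a` not in `p` and `r` is condensed on `s` (if `r`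
starts with an `X`-letter) or on `p` (if it starts with a `Y`-letter); `Y_a r` is treated
symmetrically. Hence `u ▷_{m+1,n+1} v` passes to the factors at the first occurrence of a letter, as
`▷_{m+1,n}` on the right (`EquivX.right`) and as `◁_{m,n}` on the left (`EquivX.left`), and
conversely it is controlled by these factors (`equivX_succ_of`). By induction, the relations are
congruences (`equiv_append`) and are preserved by substitutions (`EquivX.flatMap`). Therefore a
finite monoid is in `R_m` if and only if it satisfies some `▷_{m,n}`, and a language is in `𝓡_m` if
and only if it is saturated by some `▷_{m,n}` (`pvR_iff`, `mem_langR_iff`).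

For `R_{m+1} ⊆ K ⓜ L_m`, a power `e^p` of a word `e` that is idempotent modulo `◁_{m,n}` absorbs on
its right, modulo `▷_{m+1,n}`, any word equivalent to `e` (`equivX_wordPow_append`): rankers
starting with `Y` do not distinguish the two words by the hypothesis, and each letter of the first
`X`-block of a ranker consumes at most one factor `e`.

For `K ⓜ L_m ⊆ R_{m+1}`, let `T → N` be the morphism of the definition, with `N` in `L_m`. Both `N`
and `T` satisfy `f b f = f` whenever the idempotent `f` has `b` as a factor
(`pvL.idempotent_absorbs`). Reading a word in `T` from an element `s`, the first letter that leaves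
the `R`-class of `s` then cannot occur earlier in the word, so that it is a first occurrence. The
factor before it acts on `s` through its image in `N` only (`mul_eq_mul_of_fiber`), and one
continues with the factor after it; the number of steps is bounded by the size of `T`
(`mul_prod_eq_of_equivX`).

The equality `R_2 = R` (`pvR_two_iff`) uses that `◁_{1,n}` compares the subwords of length at most
`n`. If `t = s p` and `s = t q` in a monoid of `R_2`, then a large power of the word `p q` absorbs
`p` on its right, whence `t = s`. Conversely, in an `R`-trivial monoid, the value of a word, if
idempotent, absorbs the letters of that word, so that such a monoid is in `K ⓜ L_1`, by means of the
morphism that maps a word to its set of letters.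

For languages, the set of words on which a given ranker is condensed is a visibly deterministic
product (`condLanguage_eq_markedProduct`), which gives `𝓡_{m+1} ⊆ 𝓛_m^vdet`. Conversely, a pumping
argument shows that the syntactic monoid of a deterministic product of languages of `𝓛_m` is in
`K ⓜ L_m` (`IsDet.absorb`, `IsDet.mem_langR`). The statements on `L_{m+1}` are the images of those on
`R_{m+1}` under the left-right symmetry, that is, reversal of words and passage to opposite monoids.
-/

namespace RankerHierarchy

variable {A : Type}

/-! ### A recursive form of condensedness -/

/-- Of the two factors of a factorization `p a s`, the one in which a condensed run continues when
the remaining ranker is `r`: the right one if `r` starts with an `X`-letter, the left one if it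
starts with a `Y`-letter. -/
def nextPart (r : List (RankerLetter A)) (p s : List A) : List A :=
  match r with
  | .X _ :: _ => s
  | _ => p

@[simp] lemma nextPart_X (a : A) (r : List (RankerLetter A)) (p s : List A) :
    nextPart (.X a :: r) p s = s := rfl

@[simp] lemma nextPart_Y (a : A) (r : List (RankerLetter A)) (p s : List A) :
    nextPart (.Y a :: r) p s = p := rfl

/-- Condensedness by recursion on the ranker.  The letter `X a` cuts the word at its first `a`, the
letter `Y a` at its last `a`, and the rest of the ranker has to be condensed on one of the two
factors, considered as a word of its own.  The empty ranker counts as condensed. -/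
def Cond : List (RankerLetter A) → List A → Prop
  | [], _ => True
  | .X a :: r, u => ∃ p s, u = p ++ a :: s ∧ a ∉ p ∧ Cond r (nextPart r p s)
  | .Y a :: r, u => ∃ p s, u = p ++ a :: s ∧ a ∉ s ∧ Cond r (nextPart r p s)

/-- Condensed runs starting from the open interval `(i, j)`, by recursion on the ranker.  Between
two letters, the current position of the run is an endpoint of the current interval: the left one if the
next letter is an `X`-letter, the right one if it is a `Y`-letter. -/
def CondI (u : List A) : List (RankerLetter A) → ℕ → ℕ → Prop
  | [], _, _ => True
  | [Z], i, j => ∃ p, Z.Goes u (if Z.isX then i else j) p ∧ i < p ∧ p < j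
  | Z :: Z' :: r, i, j => ∃ i' j', NextInterval u Z Z' i j i' j' ∧
      Set.Ioo i' j' ⊂ Set.Ioo i j ∧ CondI u (Z' :: r) i' j'

lemma NextInterval.goes_iff {u : List A} {Z Z' : RankerLetter A} {i j i' j' q : ℕ}
    (h : NextInterval u Z Z' i j i' j') :
    Z.Goes u (if Z.isX then i else j) q ↔ q = if Z'.isX then i' else j' := by
  cases Z <;> cases Z' <;> simp only [NextInterval, RankerLetter.Goes, RankerLetter.isX,
    NextRight, NextLeft, if_true, Bool.false_eq_true, if_false] at h ⊢
  · exact ⟨fun hq => hq.unique h.1, fun hq => hq ▸ h.1⟩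
  · exact ⟨fun hq => hq.unique h.2, fun hq => hq ▸ h.2⟩
  · exact ⟨fun hq => hq.unique h.1, fun hq => hq ▸ h.1⟩
  · exact ⟨fun hq => hq.unique h.2, fun hq => hq ▸ h.2⟩

/-- A condensed run from an arbitrary interval, given by its chain of intervals, in the form of
`CondI`. -/
lemma exists_chain_iff_condI (u : List A) (Z : RankerLetter A) (r : List (RankerLetter A))
    (i₀ j₀ : ℕ) :
    (∃ (p : ℕ) (i j : ℕ → ℕ), Goes u (Z :: r) (if Z.isX then i₀ else j₀) p ∧
      i 0 = i₀ ∧ j 0 = j₀ ∧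
      (∀ ℓ, ∀ Z₁ Z₂ : RankerLetter A, (Z :: r)[ℓ]? = some Z₁ → (Z :: r)[ℓ + 1]? = some Z₂ →
        NextInterval u Z₁ Z₂ (i ℓ) (j ℓ) (i (ℓ + 1)) (j (ℓ + 1)) ∧
        Set.Ioo (i (ℓ + 1)) (j (ℓ + 1)) ⊂ Set.Ioo (i ℓ) (j ℓ)) ∧
      p ∈ Set.Ioo (i r.length) (j r.length)) ↔ CondI u (Z :: r) i₀ j₀ := by
  induction r generalizing Z i₀ j₀ with
  | nil =>
    constructor
    · rintro ⟨p, i, j, ⟨q, hq, rfl⟩, rfl, rfl, -, hp⟩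
      exact ⟨_, hq, hp.1, hp.2⟩
    · rintro ⟨p, hp, h⟩
      exact ⟨p, fun _ => i₀, fun _ => j₀, ⟨p, hp, rfl⟩, rfl, rfl, by simp, h⟩
  | cons Z' r ih =>
    constructor
    · rintro ⟨p, i, j, ⟨q, hq, hr⟩, rfl, rfl, hc, hp⟩
      have h0 := hc 0 Z Z' rfl rfl
      rw [h0.1.goes_iff] at hq
      subst hq
      exact ⟨_, _, h0.1, h0.2, (ih Z' _ _).1 ⟨p, fun ℓ => i (ℓ + 1), fun ℓ => j (ℓ + 1), hr, rfl,
        rfl, fun ℓ Z₁ Z₂ h1 h2 => hc (ℓ + 1) Z₁ Z₂ h1 h2, hp⟩⟩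
    · rintro ⟨i', j', hn, hs, hr⟩
      obtain ⟨p, i, j, hg, rfl, rfl, hc, hp⟩ := (ih Z' _ _).2 hr
      refine ⟨p, fun ℓ => Nat.casesOn ℓ i₀ i, fun ℓ => Nat.casesOn ℓ j₀ j,
        ⟨_, hn.goes_iff.2 rfl, hg⟩, rfl, rfl, ?_, hp⟩
      rintro (_ | ℓ) Z₁ Z₂ h1 h2
      · simp only [List.getElem?_cons_zero, Option.some.injEq, List.getElem?_cons_succ] at h1 h2
        subst h1 h2
        exact ⟨hn, hs⟩
      · exact hc ℓ Z₁ Z₂ h1 h2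

lemma isCondensedOn_iff_condI (r : List (RankerLetter A)) (u : List A) :
    IsCondensedOn r u ↔ r ≠ [] ∧ CondI u r 0 (u.length + 1) := by
  rcases r with _ | ⟨Z, r⟩
  · simp [IsCondensedOn, DefinesPosition]
  · have : ∀ p, DefinesPosition (Z :: r) u p ↔
        Goes u (Z :: r) (if Z.isX then 0 else u.length + 1) p := by
      intro p
      cases Z <;> rfl
    simp only [IsCondensedOn, this, ne_eq, reduceCtorEq, not_false_eq_true, true_and]
    exact exists_chain_iff_condI u Z r 0 (u.length + 1)

lemma CondI.lt {u : List A} {Z : RankerLetter A} {r : List (RankerLetter A)} {i j : ℕ}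
    (h : CondI u (Z :: r) i j) : ∃ p, i < p ∧ p < j := by
  induction r generalizing Z i j with
  | nil =>
    obtain ⟨p, -, h⟩ := h
    exact ⟨p, h⟩
  | cons Z' r ih =>
    obtain ⟨i', j', -, hs, h⟩ := h
    obtain ⟨p, hp⟩ := ih h
    exact ⟨p, hs.1 hp⟩

lemma hasLetterAt_middle {x w y : List A} {k : ℕ} {a : A} :
    HasLetterAt (x ++ w ++ y) (x.length + k + 1) a ↔ (w ++ y)[k]? = some a := by
  rw [HasLetterAt, List.append_assoc, List.getElem?_append_right (by omega)]
  have : x.length + k + 1 - 1 - x.length = k := by omega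
  rw [this]
  exact and_iff_right (by omega)

/-- Inside the factor `w` of `x w y`, the instruction `X a` finds the first `a` of `w`. -/
lemma nextRight_middle {x w y : List A} {a : A} {q : ℕ} :
    NextRight (x ++ w ++ y) a x.length q ∧ q < x.length + w.length + 1 ↔
      ∃ p s, w = p ++ a :: s ∧ a ∉ p ∧ q = x.length + p.length + 1 := by
  constructor
  · rintro ⟨⟨⟨h1, h2⟩, h3⟩, h4⟩
    obtain ⟨k, rfl⟩ : ∃ k, q = x.length + k + 1 := ⟨q - x.length - 1, by omega⟩
    rw [hasLetterAt_middle, List.getElem?_append_left (by omega)] at h2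
    obtain ⟨hk, h2⟩ := List.getElem?_eq_some_iff.1 h2
    refine ⟨w.take k, w.drop (k + 1), ?_, ?_, ?_⟩
    · rw [← h2, ← List.drop_eq_getElem_cons hk, List.take_append_drop]
    · intro hm
      obtain ⟨l, hl, hla⟩ := List.mem_iff_getElem.1 hm
      simp only [List.length_take, lt_min_iff] at hl
      have := @h3 (x.length + l + 1) ⟨by omega, by
        rw [hasLetterAt_middle, List.getElem?_append_left hl.2, List.getElem?_eq_getElem hl.2]
        simpa using hla⟩
      omega
    · simp only [List.length_take]
      omega
  · rintro ⟨p, s, rfl, hp, rfl⟩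
    refine ⟨⟨⟨by omega, ?_⟩, ?_⟩, by simp⟩
    · rw [hasLetterAt_middle]
      simp
    · rintro q ⟨h1, h2⟩
      obtain ⟨k, rfl⟩ : ∃ k, q = x.length + k + 1 := ⟨q - x.length - 1, by omega⟩
      by_contra hlt
      have hk : k < p.length := by omega
      rw [hasLetterAt_middle, List.append_assoc, List.getElem?_append_left hk] at h2
      exact hp (List.mem_of_getElem? h2)

/-- Inside the factor `w` of `x w y`, the instruction `Y a` finds the last `a` of `w`. -/
lemma nextLeft_middle {x w y : List A} {a : A} {q : ℕ} :
    NextLeft (x ++ w ++ y) a (x.length + w.length + 1) q ∧ x.length < q ↔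
      ∃ p s, w = p ++ a :: s ∧ a ∉ s ∧ q = x.length + p.length + 1 := by
  constructor
  · rintro ⟨⟨⟨h1, h2⟩, h3⟩, h4⟩
    obtain ⟨k, rfl⟩ : ∃ k, q = x.length + k + 1 := ⟨q - x.length - 1, by omega⟩
    rw [hasLetterAt_middle, List.getElem?_append_left (by omega)] at h2
    obtain ⟨hk, h2⟩ := List.getElem?_eq_some_iff.1 h2
    refine ⟨w.take k, w.drop (k + 1), ?_, ?_, ?_⟩
    · rw [← h2, ← List.drop_eq_getElem_cons hk, List.take_append_drop]
    · intro hm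
      obtain ⟨l, hl, hla⟩ := List.mem_iff_getElem.1 hm
      simp only [List.length_drop] at hl
      have hl' : k + 1 + l < w.length := by omega
      have := @h3 (x.length + (k + 1 + l) + 1) ⟨by omega, by
        rw [hasLetterAt_middle, List.getElem?_append_left hl', List.getElem?_eq_getElem hl']
        simpa using hla⟩
      omega
    · simp only [List.length_take]
      omega
  · rintro ⟨p, s, rfl, hp, rfl⟩
    refine ⟨⟨⟨by simp, ?_⟩, ?_⟩, by omega⟩
    · rw [hasLetterAt_middle]
      simp
    · rintro q ⟨h1, h2⟩
      by_contra hlt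
      obtain ⟨k, rfl⟩ : ∃ k, q = x.length + (p.length + 1 + k) + 1 :=
        ⟨q - x.length - 1 - p.length - 1, by omega⟩
      simp only [List.length_append, List.length_cons] at h1
      have hk : k < s.length := by omega
      rw [hasLetterAt_middle, List.append_assoc, List.getElem?_append_right (by omega),
        show p.length + 1 + k - p.length = k + 1 by omega, List.cons_append,
        List.getElem?_cons_succ, List.getElem?_append_left hk] at h2
      exact hp (List.mem_of_getElem? h2)

/-- A condensed run inside the interval of positions of the factor `w` only depends on `w`. -/
lemma condI_middle (r : List (RankerLetter A)) (x w y : List A) :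
    CondI (x ++ w ++ y) r x.length (x.length + w.length + 1) ↔ Cond r w := by
  induction r generalizing x w y with
  | nil => simp [CondI, Cond]
  | cons Z r ih =>
    -- passing to the factor `s`, or `p`, of `w = p a s`
    have hright : ∀ (a : A) (p s : List A), w = p ++ a :: s →
        (CondI (x ++ w ++ y) r (x.length + p.length + 1) (x.length + w.length + 1) ↔
          Cond r s) := by
      rintro a p s rfl
      rw [← ih (x ++ p ++ [a]) s y]
      simp only [List.append_assoc, List.cons_append, List.nil_append, List.length_append,
        List.length_cons, List.length_nil]
      ring_nf
    have hleft : ∀ (a : A) (p s : List A), w = p ++ a :: s →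
        (CondI (x ++ w ++ y) r x.length (x.length + p.length + 1) ↔ Cond r p) := by
      rintro a p s rfl
      rw [← ih x p (a :: s ++ y)]
      simp only [List.append_assoc]
    rcases r with _ | ⟨Z', r⟩
    · cases Z with
      | X a =>
        simp only [CondI, Cond, RankerLetter.Goes, RankerLetter.isX, if_true, and_true]
        constructor
        · rintro ⟨q, h1, -, h3⟩
          obtain ⟨p, s, h, h', -⟩ := nextRight_middle.1 ⟨h1, h3⟩
          exact ⟨p, s, h, h'⟩
        · rintro ⟨p, s, h, h'⟩
          obtain ⟨h1, h2⟩ := (nextRight_middle (y := y)).2 ⟨p, s, h, h', rfl⟩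
          exact ⟨_, h1, by omega, h2⟩
      | Y a =>
        simp only [CondI, Cond, RankerLetter.Goes, RankerLetter.isX, Bool.false_eq_true, if_false,
          and_true]
        constructor
        · rintro ⟨q, h1, h2, -⟩
          obtain ⟨p, s, h, h', -⟩ := nextLeft_middle.1 ⟨h1, h2⟩
          exact ⟨p, s, h, h'⟩
        · rintro ⟨p, s, h, h'⟩
          obtain ⟨h1, h2⟩ := (nextLeft_middle (y := y)).2 ⟨p, s, h, h', rfl⟩
          exact ⟨_, h1, h2, by subst h; simp⟩
    · -- the inclusion of intervals is strict, as the new endpoint is in the old interval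
      have hss1 : ∀ {i j i' : ℕ}, i < i' → i' < j → Set.Ioo i' j ⊂ Set.Ioo i j :=
        fun {i j i'} h1 h2 => ⟨fun k hk => ⟨h1.trans hk.1, hk.2⟩,
          fun h => lt_irrefl _ (h (show i' ∈ Set.Ioo i j from ⟨h1, h2⟩)).1⟩
      have hss2 : ∀ {i j j' : ℕ}, i < j' → j' < j → Set.Ioo i j' ⊂ Set.Ioo i j :=
        fun {i j j'} h1 h2 => ⟨fun k hk => ⟨hk.1, hk.2.trans h2⟩,
          fun h => lt_irrefl _ (h (show j' ∈ Set.Ioo i j from ⟨h1, h2⟩)).2⟩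
      cases Z with
      | X a =>
        cases Z' with
        | X b =>
          simp only [CondI, Cond, NextInterval, nextPart]
          constructor
          · rintro ⟨i', j', ⟨h1, rfl⟩, -, h3⟩
            obtain ⟨k, hk1, hk2⟩ := h3.lt
            obtain ⟨p, s, h, h', rfl⟩ := nextRight_middle.1 ⟨h1, hk1.trans hk2⟩
            exact ⟨p, s, h, h', (hright a p s h).1 h3⟩
          · rintro ⟨p, s, h, h', h3⟩
            obtain ⟨h1, h2⟩ := (nextRight_middle (y := y)).2 ⟨p, s, h, h', rfl⟩
            exact ⟨_, _, ⟨h1, rfl⟩, hss1 (by omega) h2, (hright a p s h).2 h3⟩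
        | Y b =>
          simp only [CondI, Cond, NextInterval, nextPart]
          constructor
          · rintro ⟨i', j', ⟨rfl, h1⟩, h2, h3⟩
            obtain ⟨k, hk1, hk2⟩ := h3.lt
            have hj : j' < x.length + w.length + 1 := by
              by_contra hj
              exact h2.2 fun l hl => ⟨hl.1, by have := hl.2; omega⟩
            obtain ⟨p, s, h, h', rfl⟩ := nextRight_middle.1 ⟨h1, hj⟩
            exact ⟨p, s, h, h', (hleft a p s h).1 h3⟩
          · rintro ⟨p, s, h, h', h3⟩
            obtain ⟨h1, h2⟩ := (nextRight_middle (y := y)).2 ⟨p, s, h, h', rfl⟩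
            exact ⟨_, _, ⟨rfl, h1⟩, hss2 (by omega) h2, (hleft a p s h).2 h3⟩
      | Y a =>
        cases Z' with
        | Y b =>
          simp only [CondI, Cond, NextInterval, nextPart]
          constructor
          · rintro ⟨i', j', ⟨rfl, h1⟩, -, h3⟩
            obtain ⟨k, hk1, hk2⟩ := h3.lt
            obtain ⟨p, s, h, h', rfl⟩ := nextLeft_middle.1 ⟨h1, hk1.trans hk2⟩
            exact ⟨p, s, h, h', (hleft a p s h).1 h3⟩
          · rintro ⟨p, s, h, h', h3⟩
            obtain ⟨h1, h2⟩ := (nextLeft_middle (y := y)).2 ⟨p, s, h, h', rfl⟩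
            exact ⟨_, _, ⟨rfl, h1⟩, hss2 h2 (by subst h; simp), (hleft a p s h).2 h3⟩
        | X b =>
          simp only [CondI, Cond, NextInterval, nextPart]
          constructor
          · rintro ⟨i', j', ⟨h1, rfl⟩, h2, h3⟩
            have hi : x.length < i' := by
              by_contra hi
              exact h2.2 fun l hl => ⟨by have := hl.1; omega, hl.2⟩
            obtain ⟨p, s, h, h', rfl⟩ := nextLeft_middle.1 ⟨h1, hi⟩
            exact ⟨p, s, h, h', (hright a p s h).1 h3⟩
          · rintro ⟨p, s, h, h', h3⟩
            obtain ⟨h1, h2⟩ := (nextLeft_middle (y := y)).2 ⟨p, s, h, h', rfl⟩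
            exact ⟨_, _, ⟨h1, rfl⟩, hss1 h2 (by subst h; simp), (hright a p s h).2 h3⟩

lemma isCondensedOn_iff (r : List (RankerLetter A)) (u : List A) :
    IsCondensedOn r u ↔ r ≠ [] ∧ Cond r u := by
  rw [isCondensedOn_iff_condI]
  have := condI_middle r [] u []
  simp only [List.nil_append, List.append_nil, List.length_nil, zero_add] at this
  rw [this]


/-! ### The mirror symmetry -/

/-- The left-right mirror image of a ranker letter. -/
def RankerLetter.mirror : RankerLetter A → RankerLetter A
  | .X a => .Y a
  | .Y a => .X a

@[simp] lemma RankerLetter.mirror_mirror (Z : RankerLetter A) : Z.mirror.mirror = Z := by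
  cases Z <;> rfl

lemma map_mirror_mirror (r : List (RankerLetter A)) :
    (r.map RankerLetter.mirror).map RankerLetter.mirror = r := by
  simp [Function.comp_def]

lemma numBlocks_map_mirror (r : List (RankerLetter A)) :
    numBlocks (r.map RankerLetter.mirror) = numBlocks r := by
  induction r with
  | nil => rfl
  | cons Z r ih =>
    rcases r with _ | ⟨Z', r⟩
    · rfl
    · simp only [List.map_cons, numBlocks] at ih ⊢
      rw [ih]
      cases Z <;> cases Z' <;> simp [RankerLetter.mirror, RankerLetter.isX]

lemma cond_map_mirror_of_cond {r : List (RankerLetter A)} {u : List A} (h : Cond r u) :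
    Cond (r.map RankerLetter.mirror) u.reverse := by
  induction r generalizing u with
  | nil => trivial
  | cons Z r ih =>
    have hpart : ∀ p s : List A, Cond r (nextPart r p s) →
        Cond (r.map RankerLetter.mirror)
          (nextPart (r.map RankerLetter.mirror) s.reverse p.reverse) := by
      intro p s h
      rcases r with _ | ⟨Z', r⟩
      · trivial
      · cases Z' <;> exact ih h
    cases Z with
    | X a =>
      obtain ⟨p, s, rfl, hp, h⟩ := h
      exact ⟨s.reverse, p.reverse, by simp, by simpa using hp, hpart p s h⟩
    | Y a =>
      obtain ⟨p, s, rfl, hp, h⟩ := h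
      exact ⟨s.reverse, p.reverse, by simp, by simpa using hp, hpart p s h⟩

lemma cond_map_mirror {r : List (RankerLetter A)} {u : List A} :
    Cond (r.map RankerLetter.mirror) u.reverse ↔ Cond r u := by
  refine ⟨fun h => ?_, cond_map_mirror_of_cond⟩
  have := cond_map_mirror_of_cond h
  rwa [map_mirror_mirror, List.reverse_reverse] at this

lemma cond_reverse {r : List (RankerLetter A)} {u : List A} :
    Cond r u.reverse ↔ Cond (r.map RankerLetter.mirror) u := by
  rw [← cond_map_mirror, List.reverse_reverse]

/-! ### Cutting a word at the first occurrence of a letter -/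

lemma append_cons_inj_of_notMem {a : A} {p s p' s' : List A} (h : p ++ a :: s = p' ++ a :: s')
    (hp : a ∉ p) (hp' : a ∉ p') : p = p' ∧ s = s' := by
  induction p generalizing p' with
  | nil =>
    rcases p' with _ | ⟨b, p'⟩
    · simpa using h
    · simp only [List.nil_append, List.cons_append, List.cons.injEq] at h
      exact absurd (by simp [h.1]) hp'
  | cons b p ih =>
    rcases p' with _ | ⟨b', p'⟩
    · simp only [List.nil_append, List.cons_append, List.cons.injEq] at h
      exact absurd (by simp [h.1]) hp
    · simp only [List.cons_append, List.cons.injEq] at h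
      obtain ⟨rfl, h⟩ := h
      have := ih h (fun h => hp (List.mem_cons_of_mem _ h)) fun h => hp' (List.mem_cons_of_mem _ h)
      simpa using this

lemma cond_X_of_split {a : A} {p s : List A} {r : List (RankerLetter A)} (hp : a ∉ p) :
    Cond (.X a :: r) (p ++ a :: s) ↔ Cond r (nextPart r p s) := by
  constructor
  · rintro ⟨p', s', h, hp', hc⟩
    obtain ⟨rfl, rfl⟩ := append_cons_inj_of_notMem h hp hp'
    exact hc
  · exact fun h => ⟨p, s, rfl, hp, h⟩

lemma cond_Y_of_split {a : A} {p s : List A} {r : List (RankerLetter A)} (hs : a ∉ s) :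
    Cond (.Y a :: r) (p ++ a :: s) ↔ Cond r (nextPart r p s) := by
  constructor
  · rintro ⟨p', s', h, hs', hc⟩
    have h' : s.reverse ++ a :: p.reverse = s'.reverse ++ a :: p'.reverse := by
      simpa using congrArg List.reverse h
    obtain ⟨h1, h2⟩ := append_cons_inj_of_notMem h' (by simpa using hs) (by simpa using hs')
    rw [List.reverse_inj] at h1 h2
    subst h1 h2
    exact hc
  · exact fun h => ⟨p, s, rfl, hs, h⟩

lemma Cond.mem_X {a : A} {u : List A} {r : List (RankerLetter A)} (h : Cond (.X a :: r) u) :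
    a ∈ u := by
  obtain ⟨p, s, rfl, -⟩ := h
  simp

lemma Cond.mem_Y {a : A} {u : List A} {r : List (RankerLetter A)} (h : Cond (.Y a :: r) u) :
    a ∈ u := by
  obtain ⟨p, s, rfl, -⟩ := h
  simp

lemma cond_singleton_X {a : A} {u : List A} : Cond [.X a] u ↔ a ∈ u := by
  refine ⟨Cond.mem_X, fun h => ?_⟩
  obtain ⟨p, s, rfl, hp⟩ := List.eq_append_cons_of_mem h
  exact ⟨p, s, rfl, hp, trivial⟩

/-- The last occurrence of a letter. -/
lemma exists_split_last {a : A} {u : List A} (h : a ∈ u) : ∃ p s, u = p ++ a :: s ∧ a ∉ s := by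
  obtain ⟨p, s, hu, hp⟩ := List.eq_append_cons_of_mem (List.mem_reverse.2 h)
  exact ⟨s.reverse, p.reverse, by simpa using congrArg List.reverse hu, by simpa using hp⟩

lemma cons_sublist_split {a : A} {p s l : List A} (hp : a ∉ p) :
    List.Sublist (a :: l) (p ++ a :: s) ↔ List.Sublist l s := by
  constructor
  · intro h
    induction p with
    | nil => exact List.cons_sublist_cons.1 h
    | cons b p ih =>
      rw [List.cons_append] at h
      cases h with
      | cons _ h => exact ih (fun h => hp (List.mem_cons_of_mem _ h)) h
      | cons_cons _ h => simp at hp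
  · intro h
    exact (h.cons_cons a).trans (List.sublist_append_right _ _)

lemma concat_sublist_split {a : A} {p s l : List A} (hs : a ∉ s) :
    List.Sublist (l ++ [a]) (p ++ a :: s) ↔ List.Sublist l p := by
  rw [← List.reverse_sublist, ← List.reverse_sublist (l₂ := p)]
  have := cons_sublist_split (p := s.reverse) (s := p.reverse) (l := l.reverse) (a := a)
    (by simpa using hs)
  simpa using this

/-- A ranker with a single block, of `X`-letters, tests for a (scattered) subword. -/
lemma cond_map_X {l u : List A} : Cond (l.map .X) u ↔ List.Sublist l u := by
  induction l generalizing u with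
  | nil => simp [Cond]
  | cons a l ih =>
    constructor
    · rintro ⟨p, s, rfl, hp, h⟩
      rw [cons_sublist_split hp]
      rcases l with _ | ⟨b, l⟩
      · simp
      · exact ih.1 h
    · intro h
      obtain ⟨p, s, rfl, hp⟩ := List.eq_append_cons_of_mem (h.subset List.mem_cons_self)
      rw [cons_sublist_split hp] at h
      refine ⟨p, s, rfl, hp, ?_⟩
      rcases l with _ | ⟨b, l⟩
      · trivial
      · exact ih.2 h

lemma cond_map_Y {l u : List A} : Cond (l.map .Y) u ↔ List.Sublist l.reverse u := by
  rw [← cond_map_mirror, List.map_map]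
  have : (RankerLetter.mirror ∘ RankerLetter.Y : A → RankerLetter A) = .X := rfl
  rw [this, cond_map_X, ← List.reverse_sublist, List.reverse_reverse]

/-- A ranker `Y_{b₁} ⋯ Y_{b_k} r''`, where `r''` does not start with a `Y`-letter, is condensed on a
suffix `s` as soon as it is condensed on the whole word and its first block does not leave `s`,
that is, `b_k ⋯ b₁` is a subword of `s`. -/
lemma cond_suffix_iff {l : List A} (hl : l ≠ []) {r : List (RankerLetter A)}
    (hr : ∀ a r', r ≠ .Y a :: r') (x s : List A) :
    Cond (l.map .Y ++ r) s ↔ Cond (l.map .Y ++ r) (x ++ s) ∧ List.Sublist l.reverse s := by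
  induction l generalizing s with
  | nil => exact absurd rfl hl
  | cons b l ih =>
    by_cases hb : b ∈ s
    · obtain ⟨s1, s2, rfl, hs2⟩ := exists_split_last hb
      simp only [List.map_cons, List.cons_append, List.reverse_cons]
      rw [cond_Y_of_split hs2, concat_sublist_split hs2, ← List.append_assoc, cond_Y_of_split hs2]
      rcases l with _ | ⟨b', l⟩
      · simp only [List.map_nil, List.nil_append, List.reverse_nil, List.nil_sublist, and_true]
        rcases r with _ | ⟨_ | a, r⟩
        · simp [Cond]
        · simp
        · exact absurd rfl (hr a r)
      · exact ih (by simp) s1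
    · refine iff_of_false (fun h => hb h.mem_Y) fun h => hb (h.2.subset (by simp))

lemma cond_prefix_iff {l : List A} (hl : l ≠ []) {r : List (RankerLetter A)}
    (hr : ∀ a r', r ≠ .X a :: r') (p y : List A) :
    Cond (l.map .X ++ r) p ↔ Cond (l.map .X ++ r) (p ++ y) ∧ List.Sublist l p := by
  rw [← cond_map_mirror, ← cond_map_mirror (u := p ++ y), List.map_append, List.map_map,
    List.reverse_append, ← List.reverse_sublist (l₂ := p)]
  refine cond_suffix_iff hl (fun a r' h => ?_) _ _
  have := congrArg (List.map RankerLetter.mirror) h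
  rw [map_mirror_mirror] at this
  exact hr a _ this

lemma exists_eq_map_Y_append (a : A) (r : List (RankerLetter A)) :
    ∃ (l : List A) (r' : List (RankerLetter A)), l ≠ [] ∧ (∀ b r'', r' ≠ .Y b :: r'') ∧
      (.Y a :: r) = l.map .Y ++ r' := by
  induction r generalizing a with
  | nil => exact ⟨[a], [], by simp⟩
  | cons Z r ih =>
    cases Z with
    | X b => exact ⟨[a], .X b :: r, by simp⟩
    | Y b =>
      obtain ⟨l, r', hl, hr, h⟩ := ih b
      exact ⟨a :: l, r', by simp, hr, by rw [h]; rfl⟩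

lemma exists_eq_map_X_append (a : A) (r : List (RankerLetter A)) :
    ∃ (l : List A) (r' : List (RankerLetter A)), l ≠ [] ∧ (∀ b r'', r' ≠ .X b :: r'') ∧
      (.X a :: r) = l.map .X ++ r' := by
  induction r generalizing a with
  | nil => exact ⟨[a], [], by simp⟩
  | cons Z r ih =>
    cases Z with
    | Y b => exact ⟨[a], .Y b :: r, by simp⟩
    | X b =>
      obtain ⟨l, r', hl, hr, h⟩ := ih b
      exact ⟨a :: l, r', by simp, hr, by rw [h]; rfl⟩

/-! ### Numbers of blocks -/

@[simp] lemma numBlocks_X_X (a b : A) (r : List (RankerLetter A)) :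
    numBlocks (.X a :: .X b :: r) = numBlocks (.X b :: r) := by
  simp [numBlocks, RankerLetter.isX]

@[simp] lemma numBlocks_X_Y (a b : A) (r : List (RankerLetter A)) :
    numBlocks (.X a :: .Y b :: r) = numBlocks (.Y b :: r) + 1 := by
  simp [numBlocks, RankerLetter.isX]

lemma numBlocks_pos {r : List (RankerLetter A)} (hr : r ≠ []) : 1 ≤ numBlocks r := by
  induction r with
  | nil => exact absurd rfl hr
  | cons Z r ih =>
    rcases r with _ | ⟨Z', r⟩
    · exact le_rfl
    · exact (ih (by simp)).trans (Nat.le_add_right _ _)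

lemma numBlocks_le_length (r : List (RankerLetter A)) : numBlocks r ≤ r.length := by
  induction r with
  | nil => exact le_rfl
  | cons Z r ih =>
    rcases r with _ | ⟨Z', r⟩
    · exact le_rfl
    · simp only [numBlocks, List.length_cons] at ih ⊢
      split_ifs <;> omega

lemma numBlocks_map_X {l : List A} (hl : l ≠ []) : numBlocks (l.map .X) = 1 := by
  induction l with
  | nil => exact absurd rfl hl
  | cons a l ih =>
    rcases l with _ | ⟨b, l⟩
    · rfl
    · simp only [List.map_cons, numBlocks_X_X]
      exact ih (by simp)

lemma numBlocks_map_Y {l : List A} (hl : l ≠ []) : numBlocks (l.map .Y) = 1 := by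
  rw [← numBlocks_map_mirror, List.map_map]
  exact numBlocks_map_X hl

lemma exists_eq_map_X_of_numBlocks {a : A} {r : List (RankerLetter A)}
    (h : numBlocks (.X a :: r) = 1) : ∃ l : List A, (.X a :: r) = l.map RankerLetter.X := by
  induction r generalizing a with
  | nil => exact ⟨[a], rfl⟩
  | cons Z r ih =>
    cases Z with
    | X b =>
      obtain ⟨l, hl⟩ := ih (a := b) (by simpa using h)
      exact ⟨a :: l, by rw [hl]; rfl⟩
    | Y b =>
      rw [numBlocks_X_Y] at h
      have := numBlocks_pos (r := (.Y b :: r)) (by simp)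
      omega


/-! ### The relations `▷` and `◁` -/

lemma equivX_iff {m n : ℕ} {u v : List A} :
    EquivX m n u v ↔
      (∀ a r, numBlocks (.X a :: r) = m → r.length + 1 ≤ n →
        (Cond (.X a :: r) u ↔ Cond (.X a :: r) v)) ∧
      ∀ r, numBlocks r < m → r.length < n → (Cond r u ↔ Cond r v) := by
  constructor
  · refine fun h => ⟨fun a r h1 h2 => ?_, fun r h1 h2 => ?_⟩
    · simpa [isCondensedOn_iff] using h (.X a :: r) (.inl ⟨_, h2, h1, rfl, a, r, rfl⟩)
    · rcases r with _ | ⟨a | a, r⟩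
      · simp [Cond]
      · simpa [isCondensedOn_iff] using
          h (.X a :: r) (.inr ⟨_, h1, _, h2, .inl ⟨rfl, rfl, a, r, rfl⟩⟩)
      · simpa [isCondensedOn_iff] using
          h (.Y a :: r) (.inr ⟨_, h1, _, h2, .inr ⟨rfl, rfl, a, r, rfl⟩⟩)
  · rintro ⟨h1, h2⟩ r (⟨n', hn, rfl, rfl, a, r, rfl⟩ |
      ⟨m', hm, n', hn, ⟨rfl, rfl, -⟩ | ⟨rfl, rfl, -⟩⟩)
    · rw [isCondensedOn_iff, isCondensedOn_iff, h1 a r rfl hn]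
    · rw [isCondensedOn_iff, isCondensedOn_iff, h2 r hm hn]
    · rw [isCondensedOn_iff, isCondensedOn_iff, h2 r hm hn]

lemma equivY_iff {m n : ℕ} {u v : List A} :
    EquivY m n u v ↔
      (∀ a r, numBlocks (.Y a :: r) = m → r.length + 1 ≤ n →
        (Cond (.Y a :: r) u ↔ Cond (.Y a :: r) v)) ∧
      ∀ r, numBlocks r < m → r.length < n → (Cond r u ↔ Cond r v) := by
  constructor
  · refine fun h => ⟨fun a r h1 h2 => ?_, fun r h1 h2 => ?_⟩
    · simpa [isCondensedOn_iff] using h (.Y a :: r) (.inl ⟨_, h2, h1, rfl, a, r, rfl⟩)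
    · rcases r with _ | ⟨a | a, r⟩
      · simp [Cond]
      · simpa [isCondensedOn_iff] using
          h (.X a :: r) (.inr ⟨_, h1, _, h2, .inl ⟨rfl, rfl, a, r, rfl⟩⟩)
      · simpa [isCondensedOn_iff] using
          h (.Y a :: r) (.inr ⟨_, h1, _, h2, .inr ⟨rfl, rfl, a, r, rfl⟩⟩)
  · rintro ⟨h1, h2⟩ r (⟨n', hn, rfl, rfl, a, r, rfl⟩ |
      ⟨m', hm, n', hn, ⟨rfl, rfl, -⟩ | ⟨rfl, rfl, -⟩⟩)
    · rw [isCondensedOn_iff, isCondensedOn_iff, h1 a r rfl hn]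
    · rw [isCondensedOn_iff, isCondensedOn_iff, h2 r hm hn]
    · rw [isCondensedOn_iff, isCondensedOn_iff, h2 r hm hn]

lemma equivY_reverse {m n : ℕ} {u v : List A} :
    EquivY m n u.reverse v.reverse ↔ EquivX m n u v := by
  rw [equivY_iff, equivX_iff]
  simp only [cond_reverse]
  have hY : ∀ (a : A) (r : List (RankerLetter A)),
      (RankerLetter.Y a :: r.map .mirror).map .mirror = RankerLetter.X a :: r := fun a r => by
    rw [List.map_cons, map_mirror_mirror]
    rfl
  refine and_congr ⟨fun h a r h1 h2 => ?_, fun h a r h1 h2 => ?_⟩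
    ⟨fun h r h1 h2 => ?_, fun h r h1 h2 => ?_⟩
  · have := h a (r.map .mirror) (by rw [← h1, ← numBlocks_map_mirror, hY]) (by simpa using h2)
    rwa [hY] at this
  · exact h a (r.map .mirror) (by rw [← h1, ← numBlocks_map_mirror (.Y a :: r)]; rfl)
      (by simpa using h2)
  · have := h (r.map .mirror) (by rwa [numBlocks_map_mirror]) (by simpa using h2)
    rwa [map_mirror_mirror] at this
  · exact h (r.map .mirror) (by rwa [numBlocks_map_mirror]) (by simpa using h2)

lemma equivX_reverse {m n : ℕ} {u v : List A} :
    EquivX m n u.reverse v.reverse ↔ EquivY m n u v := by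
  rw [← equivY_reverse, List.reverse_reverse, List.reverse_reverse]

@[refl] lemma EquivX.refl (m n : ℕ) (u : List A) : EquivX m n u u := fun _ _ => Iff.rfl

@[refl] lemma EquivY.refl (m n : ℕ) (u : List A) : EquivY m n u u := fun _ _ => Iff.rfl

lemma EquivX.symm {m n : ℕ} {u v : List A} (h : EquivX m n u v) : EquivX m n v u :=
  fun r hr => (h r hr).symm

lemma EquivY.symm {m n : ℕ} {u v : List A} (h : EquivY m n u v) : EquivY m n v u :=
  fun r hr => (h r hr).symm

lemma EquivX.trans {m n : ℕ} {u v w : List A} (h : EquivX m n u v) (h' : EquivX m n v w) :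
    EquivX m n u w := fun r hr => (h r hr).trans (h' r hr)

lemma EquivY.trans {m n : ℕ} {u v w : List A} (h : EquivY m n u v) (h' : EquivY m n v w) :
    EquivY m n u w := fun r hr => (h r hr).trans (h' r hr)

lemma EquivX.mono {m n n' : ℕ} {u v : List A} (h : EquivX m n u v) (hn : n' ≤ n) :
    EquivX m n' u v := by
  rw [equivX_iff] at h ⊢
  exact ⟨fun a r h1 h2 => h.1 a r h1 (h2.trans hn), fun r h1 h2 => h.2 r h1 (h2.trans_le hn)⟩

lemma EquivY.mono {m n n' : ℕ} {u v : List A} (h : EquivY m n u v) (hn : n' ≤ n) :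
    EquivY m n' u v := by
  rw [← equivX_reverse] at h ⊢
  exact h.mono hn

lemma EquivX.lower {m m' n : ℕ} {u v : List A} (h : EquivX m (n + 1) u v) (hm : m' < m) :
    EquivX m' n u v ∧ EquivY m' n u v := by
  rw [equivX_iff] at h ⊢
  rw [equivY_iff]
  exact ⟨⟨fun a r h1 h2 => h.2 _ (by omega) (by simpa using by omega),
      fun r h1 h2 => h.2 r (by omega) (by omega)⟩,
    ⟨fun a r h1 h2 => h.2 _ (by omega) (by simpa using by omega),
      fun r h1 h2 => h.2 r (by omega) (by omega)⟩⟩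

lemma EquivX.mem_iff {m n : ℕ} {u v : List A} (h : EquivX m n u v) (hm : 1 ≤ m) (hn : m ≤ n)
    (a : A) : a ∈ u ↔ a ∈ v := by
  rw [equivX_iff] at h
  rw [← cond_singleton_X, ← cond_singleton_X]
  obtain rfl | hm := hm.eq_or_lt
  · exact h.1 a [] rfl (by simpa using hn)
  · exact h.2 [.X a] hm (by simpa using by omega)

lemma EquivY.mem_iff {m n : ℕ} {u v : List A} (h : EquivY m n u v) (hm : 1 ≤ m) (hn : m ≤ n)
    (a : A) : a ∈ u ↔ a ∈ v := by
  simpa using (equivX_reverse.2 h).mem_iff hm hn a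

/-- Equivalent words have equivalent factors to the right of the first `a`.  Rankers that start with
a `Y`-letter are handled by `cond_suffix_iff`; whether their first block stays in the factor is
tested by a ranker with a single block, which is available as the given ranker has fewer than `m`
blocks. -/
lemma EquivX.right {m n : ℕ} {a : A} {u₁ u₂ v₁ v₂ : List A}
    (h : EquivX m (n + 1) (u₁ ++ a :: u₂) (v₁ ++ a :: v₂)) (hu : a ∉ u₁) (hv : a ∉ v₁) :
    EquivX m n u₂ v₂ := by
  rw [equivX_iff] at h ⊢
  have key : ∀ b r, numBlocks (.X a :: .X b :: r) ≤ m → r.length + 1 ≤ n →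
      (numBlocks (.X a :: .X b :: r) = m ∨ r.length + 1 < n) →
      (Cond (.X b :: r) u₂ ↔ Cond (.X b :: r) v₂) := by
    intro b r h1 h2 h3
    have : Cond (.X a :: .X b :: r) (u₁ ++ a :: u₂) ↔ Cond (.X a :: .X b :: r) (v₁ ++ a :: v₂) := by
      obtain h4 | h4 := h1.eq_or_lt
      · exact h.1 a (.X b :: r) h4 (by simpa using h2)
      · exact h.2 (.X a :: .X b :: r) h4 (by simpa using by omega)
    rwa [cond_X_of_split hu, cond_X_of_split hv] at this
  refine ⟨fun b r h1 h2 => key b r (by simp [h1]) h2 (.inl (by simpa using h1)), ?_⟩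
  intro r h1 h2
  rcases r with _ | ⟨b | b, r⟩
  · simp [Cond]
  · simp only [List.length_cons] at h2
    exact key b r (by simpa using h1.le) h2.le (.inr h2)
  · have hpos := numBlocks_pos (r := RankerLetter.Y b :: r) (by simp)
    obtain ⟨l, r', hl, hr, hbr⟩ := exists_eq_map_Y_append b r
    have hlen := congrArg List.length hbr
    rw [hbr] at h1 h2 ⊢
    simp only [List.length_append, List.length_map] at h2
    rw [cond_suffix_iff hl hr (u₁ ++ [a]) u₂, cond_suffix_iff hl hr (v₁ ++ [a]) v₂]
    simp only [List.append_assoc, List.cons_append, List.nil_append]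
    refine and_congr (h.2 _ h1 (by simp; omega)) ?_
    rw [← cons_sublist_split hu (s := u₂), ← cons_sublist_split hv (s := v₂), ← cond_map_X,
      ← cond_map_X]
    refine h.2 ((a :: l.reverse).map .X) ?_ (by simp; omega)
    rw [numBlocks_map_X (by simp)]
    rw [hbr] at hpos
    omega

/-- Equivalent words have equivalent factors to the left of the first `a`.  The argument is that of
`EquivX.right`, by means of `cond_prefix_iff`. -/
lemma EquivX.left {m n : ℕ} {a : A} {u₁ u₂ v₁ v₂ : List A}
    (h : EquivX (m + 1) (n + 1) (u₁ ++ a :: u₂) (v₁ ++ a :: v₂)) (hu : a ∉ u₁) (hv : a ∉ v₁) :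
    EquivY m n u₁ v₁ := by
  rw [equivX_iff] at h
  rw [equivY_iff]
  have key : ∀ b r, numBlocks (.Y b :: r) ≤ m → r.length + 1 ≤ n →
      (numBlocks (.Y b :: r) = m ∨ r.length + 1 < n) →
      (Cond (.Y b :: r) u₁ ↔ Cond (.Y b :: r) v₁) := by
    intro b r h1 h2 h3
    have : Cond (.X a :: .Y b :: r) (u₁ ++ a :: u₂) ↔ Cond (.X a :: .Y b :: r) (v₁ ++ a :: v₂) := by
      obtain h4 | h4 := h1.eq_or_lt
      · exact h.1 a (.Y b :: r) (by simpa using h4) (by simpa using h2)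
      · exact h.2 (.X a :: .Y b :: r) (by simpa using h4) (by simpa using by omega)
    rwa [cond_X_of_split hu, cond_X_of_split hv] at this
  refine ⟨fun b r h1 h2 => key b r h1.le h2 (.inl h1), ?_⟩
  intro r h1 h2
  rcases r with _ | ⟨b | b, r⟩
  · simp [Cond]
  · have hpos := numBlocks_pos (r := RankerLetter.X b :: r) (by simp)
    obtain ⟨l, r', hl, hr, hbr⟩ := exists_eq_map_X_append b r
    rw [hbr] at h1 h2 hpos ⊢
    simp only [List.length_append, List.length_map] at h2
    rw [cond_prefix_iff hl hr u₁ (a :: u₂), cond_prefix_iff hl hr v₁ (a :: v₂)]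
    refine and_congr (h.2 _ (by omega) (by simp; omega)) ?_
    -- the first block `l` stays in the left factor if `X_a` followed by `l` read backwards in
    -- `Y`-letters is condensed
    have hblock : ∀ p s : List A, a ∉ p →
        (List.Sublist l p ↔ Cond (.X a :: l.reverse.map .Y) (p ++ a :: s)) := by
      intro p s hp
      rw [cond_X_of_split hp]
      have : nextPart (l.reverse.map .Y) p s = p := by
        cases l.reverse <;> rfl
      rw [this, cond_map_Y, List.reverse_reverse]
    rw [hblock u₁ u₂ hu, hblock v₁ v₂ hv]
    refine h.2 _ ?_ (by simp; omega)
    obtain ⟨c, l', hl'⟩ := List.exists_cons_of_ne_nil (l := l.reverse) (by simpa using hl)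
    have h3 := numBlocks_map_Y (l := l.reverse) (by simpa using hl)
    rw [hl', List.map_cons] at h3 ⊢
    rw [numBlocks_X_Y, h3]
    omega
  · simp only [List.length_cons] at h2
    exact key b r h1.le h2.le (.inr h2)

lemma equivX_zero_left (n : ℕ) (u v : List A) : EquivX 0 n u v :=
  equivX_iff.2 ⟨fun a r h => by have := numBlocks_pos (r := RankerLetter.X a :: r) (by simp); omega,
    fun r h => by omega⟩

lemma equivX_zero_right (m : ℕ) (u v : List A) : EquivX m 0 u v :=
  equivX_iff.2 ⟨fun a r _ h => by omega, fun r _ h => by omega⟩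

lemma equivY_zero_right (m : ℕ) (u v : List A) : EquivY m 0 u v :=
  equivX_reverse.1 (equivX_zero_right m _ _)

/-- A converse of `EquivX.right` and `EquivX.left`: it is enough to compare shorter rankers with
fewer blocks, and the two factors given by the first occurrence of each letter. -/
lemma equivX_succ_of {m n : ℕ} {u v : List A}
    (low : ∀ m' < m, EquivX m' n u v ∧ EquivY m' n u v)
    (h : 1 ≤ m → m ≤ n + 1 → ∀ a, (a ∈ u ↔ a ∈ v) ∧
      ∀ u₁ u₂ v₁ v₂, u = u₁ ++ a :: u₂ → a ∉ u₁ → v = v₁ ++ a :: v₂ → a ∉ v₁ →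
        EquivX m n u₂ v₂ ∧ EquivY (m - 1) n u₁ v₁) :
    EquivX m (n + 1) u v := by
  rw [equivX_iff]
  constructor
  · intro a r hb hl
    have hm : 1 ≤ m := hb ▸ numBlocks_pos (by simp)
    have hmn : m ≤ n + 1 := by
      have := numBlocks_le_length (.X a :: r)
      simp only [List.length_cons] at this
      omega
    obtain ⟨hmem, hpart⟩ := h hm hmn a
    by_cases ha : a ∈ u
    · obtain ⟨u₁, u₂, rfl, hu⟩ := List.eq_append_cons_of_mem ha
      obtain ⟨v₁, v₂, rfl, hv⟩ := List.eq_append_cons_of_mem (hmem.1 ha)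
      obtain ⟨hr, hl'⟩ := hpart u₁ u₂ v₁ v₂ rfl hu rfl hv
      rw [cond_X_of_split hu, cond_X_of_split hv]
      rcases r with _ | ⟨b | b, r⟩
      · simp [Cond]
      · exact (equivX_iff.1 hr).1 b r (by simpa using hb) (by simpa using hl)
      · rw [numBlocks_X_Y] at hb
        exact (equivY_iff.1 hl').1 b r (by omega) (by simpa using hl)
    · exact iff_of_false (fun h => ha h.mem_X) fun h => ha (hmem.2 h.mem_X)
  · intro r hb hl
    rcases r with _ | ⟨b | b, r⟩
    · simp [Cond]
    · exact (equivX_iff.1 (low _ hb).1).1 b r rfl (by simpa using hl)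
    · exact (equivY_iff.1 (low _ hb).2).1 b r rfl (by simpa using hl)

lemma append_eq_append_cons {a : A} {x y p s : List A} (h : x ++ y = p ++ a :: s) :
    (∃ x', x = p ++ a :: x' ∧ s = x' ++ y) ∨ ∃ p', p = x ++ p' ∧ y = p' ++ a :: s := by
  rcases List.append_eq_append_iff.1 h with ⟨q, rfl, hq⟩ | ⟨q, rfl, hq⟩
  · exact .inr ⟨q, rfl, hq⟩
  · rcases q with _ | ⟨b, q⟩
    · exact .inr ⟨[], by simp, by simpa using hq.symm⟩
    · simp only [List.cons_append, List.cons.injEq] at hq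
      obtain ⟨rfl, rfl⟩ := hq
      exact .inl ⟨q, rfl, rfl⟩

/-- The first occurrence of a letter in a concatenation. -/
lemma append_split_cases {a : A} {x y p s : List A} (h : x ++ y = p ++ a :: s) (hp : a ∉ p) :
    (∃ x', x = p ++ a :: x' ∧ s = x' ++ y) ∨
      (a ∉ x ∧ ∃ p', p = x ++ p' ∧ y = p' ++ a :: s ∧ a ∉ p') := by
  rcases append_eq_append_cons h with h | ⟨q, rfl, hq⟩
  · exact .inl h
  · simp only [List.mem_append, not_or] at hp
    exact .inr ⟨hp.1, q, rfl, hq, hp.2⟩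

/-- The relations are congruences, by induction on `n` and simultaneously for `▷` and `◁`, as the
factors to the left of a first occurrence are compared by the mirror relation. -/
lemma equiv_append (n : ℕ) : ∀ (m : ℕ) (u v x y : List A),
    (EquivX m n u v → EquivX m n (x ++ (u ++ y)) (x ++ (v ++ y))) ∧
    (EquivY m n u v → EquivY m n (x ++ (u ++ y)) (x ++ (v ++ y))) := by
  induction n with
  | zero =>
    exact fun m u v x y => ⟨fun _ => equivX_zero_right _ _ _, fun _ => equivY_zero_right _ _ _⟩
  | succ n ih =>
    have hX : ∀ (m : ℕ) (u v x y : List A), EquivX m (n + 1) u v →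
        EquivX m (n + 1) (x ++ (u ++ y)) (x ++ (v ++ y)) := by
      intro m u v x y h
      refine equivX_succ_of (fun m' hm => ⟨(ih m' u v x y).1 (h.lower hm).1,
        (ih m' u v x y).2 (h.lower hm).2⟩) fun hm hmn a => ?_
      have hmem := h.mem_iff hm hmn
      refine ⟨by simp [hmem], fun u₁ u₂ v₁ v₂ hu hu₁ hv hv₁ => ?_⟩
      -- the first `a` is in `x`, in `u` and `v`, or in `y`
      obtain ⟨m, rfl⟩ : ∃ k, m = k + 1 := ⟨m - 1, by omega⟩
      rw [Nat.add_sub_cancel]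
      rcases append_split_cases hu hu₁ with ⟨x', rfl, rfl⟩ | ⟨hax, p, rfl, hu', hp⟩
      · rw [List.append_assoc, List.cons_append] at hv
        obtain ⟨rfl, rfl⟩ := append_cons_inj_of_notMem hv hu₁ hv₁
        exact ⟨(ih _ u v x' y).1 (h.mono (by omega)), EquivY.refl _ _ _⟩
      rcases append_split_cases hv hv₁ with ⟨x', rfl, rfl⟩ | ⟨-, q, rfl, hv', hq⟩
      · simp at hax
      rcases append_split_cases hu' hp with ⟨u', rfl, rfl⟩ | ⟨hau, p', rfl, rfl, hp'⟩
      · rcases append_split_cases hv' hq with ⟨v', rfl, rfl⟩ | ⟨hav, -⟩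
        · exact ⟨by simpa using (ih _ _ _ [] y).1 (h.right hp hq),
            by simpa using (ih _ _ _ x []).2 (h.left hp hq)⟩
        · exact absurd ((hmem a).1 (by simp)) hav
      · rcases append_split_cases hv' hq with ⟨v', rfl, rfl⟩ | ⟨hav, q', rfl, hq', hq''⟩
        · exact absurd ((hmem a).2 (by simp)) hau
        · obtain ⟨rfl, rfl⟩ := append_cons_inj_of_notMem hq' hp' hq''
          exact ⟨EquivX.refl _ _ _, (ih _ u v x p').2 (h.lower (by omega)).2⟩
    refine fun m u v x y => ⟨hX m u v x y, fun h => ?_⟩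
    rw [← equivX_reverse] at h ⊢
    simpa using hX m _ _ y.reverse x.reverse h

lemma EquivX.append {m n : ℕ} {u v : List A} (h : EquivX m n u v) (x y : List A) :
    EquivX m n (x ++ (u ++ y)) (x ++ (v ++ y)) := (equiv_append n m u v x y).1 h

lemma EquivY.append {m n : ℕ} {u v : List A} (h : EquivY m n u v) (x y : List A) :
    EquivY m n (x ++ (u ++ y)) (x ++ (v ++ y)) := (equiv_append n m u v x y).2 h

lemma EquivX.append_append {m n : ℕ} {u v u' v' : List A} (h : EquivX m n u v)
    (h' : EquivX m n u' v') : EquivX m n (u ++ u') (v ++ v') := by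
  have h1 := h.append [] u'
  have h2 := h'.append v []
  simp only [List.nil_append, List.append_nil] at h1 h2
  exact h1.trans h2

lemma EquivY.append_append {m n : ℕ} {u v u' v' : List A} (h : EquivY m n u v)
    (h' : EquivY m n u' v') : EquivY m n (u ++ u') (v ++ v') := by
  have h1 := h.append [] u'
  have h2 := h'.append v []
  simp only [List.nil_append, List.append_nil] at h1 h2
  exact h1.trans h2

/-! ### Stability under substitutions -/

/-- A short subword of `h(u)` is a subword of `h(w)` for some short subword `w` of `u`. -/
lemma sublist_flatMap_of_forall {B : Type} (h : A → List B) {u v : List A} {n : ℕ}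
    (huv : ∀ l : List A, l.length ≤ n → List.Sublist l u → List.Sublist l v)
    {l : List B} (hl : l.length ≤ n) (hu : List.Sublist l (u.flatMap h)) :
    List.Sublist l (v.flatMap h) := by
  have key : ∀ (u : List A) (l : List B), List.Sublist l (u.flatMap h) →
      ∃ w : List A, w.length ≤ l.length ∧ List.Sublist w u ∧ List.Sublist l (w.flatMap h) := by
    intro u
    induction u with
    | nil => exact fun l hl => ⟨[], by simp, by simp, hl⟩
    | cons a u ih =>
      intro l hl
      rw [List.flatMap_cons, List.sublist_append_iff] at hl
      obtain ⟨l₁, l₂, rfl, h1, h2⟩ := hl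
      obtain ⟨w, hw1, hw2, hw3⟩ := ih l₂ h2
      rcases l₁ with _ | ⟨b, l₁⟩
      · exact ⟨w, by simpa using hw1, hw2.cons a, by simpa using hw3⟩
      · refine ⟨a :: w, by simp; omega, hw2.cons_cons a, ?_⟩
        rw [List.flatMap_cons]
        exact h1.append hw3
  obtain ⟨w, hw1, hw2, hw3⟩ := key u l hu
  have := huv w (hw1.trans hl) hw2
  refine hw3.trans ?_
  rw [List.flatMap_def, List.flatMap_def]
  exact (this.map h).flatten

lemma equivX_one_iff {n : ℕ} {u v : List A} :
    EquivX 1 n u v ↔ ∀ l : List A, l.length ≤ n → (List.Sublist l u ↔ List.Sublist l v) := by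
  rw [equivX_iff]
  constructor
  · intro h l hl
    rcases l with _ | ⟨a, l⟩
    · simp
    · rw [← cond_map_X, ← cond_map_X]
      exact h.1 a (l.map .X) (numBlocks_map_X (l := a :: l) (by simp)) (by simpa using hl)
  · refine fun h => ⟨fun a r h1 h2 => ?_, fun r h1 _ => ?_⟩
    · obtain ⟨l, hl⟩ := exists_eq_map_X_of_numBlocks h1
      have := congrArg List.length hl
      simp only [List.length_cons, List.length_map] at this
      rw [hl, cond_map_X, cond_map_X]
      exact h l (by omega)
    · obtain rfl : r = [] := by
        by_contra hr
        have := numBlocks_pos hr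
        omega
      simp [Cond]

lemma exists_first {P : A → Prop} {u : List A} (h : ∃ b ∈ u, P b) :
    ∃ p b s, u = p ++ b :: s ∧ P b ∧ ∀ c ∈ p, ¬ P c := by
  classical
  induction u with
  | nil => simp at h
  | cons a u ih =>
    by_cases ha : P a
    · exact ⟨[], a, u, rfl, ha, by simp⟩
    · obtain ⟨p, b, s, rfl, hb, hp⟩ := ih (by simpa [ha] using h)
      exact ⟨a :: p, b, s, rfl, hb, by simpa [ha] using hp⟩

/-- If the first letters with property `P` of two equivalent words are `b` and `c`, then `b = c`:
otherwise the ranker `X_b Y_c` is condensed on the second word and not on the first. -/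
lemma EquivX.first_eq {m n : ℕ} {u₁ u₂ v₁ v₂ : List A} {b c : A} {P : A → Prop}
    (h : EquivX m n (u₁ ++ b :: u₂) (v₁ ++ c :: v₂)) (hm : 2 ≤ m) (hn : m ≤ n)
    (hb : P b) (hc : P c) (hu : ∀ d ∈ u₁, ¬ P d) (hv : ∀ d ∈ v₁, ¬ P d) : b = c := by
  by_contra hbc
  have hb2 : b ∈ v₁ ++ c :: v₂ := (h.mem_iff (by omega) hn b).1 (by simp)
  have hbv : b ∉ v₁ := fun h => hv b h hb
  have hbu : b ∉ u₁ := fun h => hu b h hb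
  have hb3 : b ∈ v₂ := by simpa [hbc, hbv] using hb2
  obtain ⟨p, s, rfl, hp⟩ := List.eq_append_cons_of_mem hb3
  have key : Cond [.X b, .Y c] (u₁ ++ b :: u₂) ↔
      Cond [.X b, .Y c] (v₁ ++ c :: (p ++ b :: s)) := by
    rw [equivX_iff] at h
    obtain rfl | hm := hm.eq_or_lt
    · exact h.1 b [.Y c] (by simp [numBlocks, RankerLetter.isX]) (by simpa using hn)
    · exact h.2 _ (by simpa [numBlocks, RankerLetter.isX] using hm) (by simpa using by omega)
  have e : v₁ ++ c :: (p ++ b :: s) = (v₁ ++ c :: p) ++ b :: s := by simp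
  rw [e, cond_X_of_split hbu, cond_X_of_split (by simp [hbv, hbc, hp]), nextPart_Y,
    nextPart_Y] at key
  obtain ⟨p', s', h1, h2⟩ := exists_split_last (a := c) (u := v₁ ++ c :: p) (by simp)
  have := (key.2 ⟨p', s', h1, h2, trivial⟩).mem_Y
  exact hu c this hc

/-- The relations are preserved by substitutions.  For `m ≥ 2`, this is by induction on `n`, as the
letter of `u` that produces the first `a` of `h(u)` is the same as for `v` (`EquivX.first_eq`); this
fails for `m = 1`, where one argues with subwords. -/
lemma EquivX.flatMap {B : Type} {n : ℕ} : ∀ {m : ℕ} {u v : List A} (h : A → List B),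
    EquivX m n u v → EquivX m n (u.flatMap h) (v.flatMap h) := by
  induction n with
  | zero => exact fun _ _ => equivX_zero_right _ _ _
  | succ n ih =>
    intro m u v h huv
    have ihY : ∀ {m : ℕ} {u v : List A}, EquivY m n u v →
        EquivY m n (u.flatMap h) (v.flatMap h) := by
      intro m u v huv
      rw [← equivX_reverse] at huv ⊢
      rw [List.reverse_flatMap, List.reverse_flatMap]
      exact ih _ huv
    rcases Nat.lt_or_ge m 2 with hm | hm
    · obtain rfl | rfl : m = 0 ∨ m = 1 := by omega
      · exact equivX_zero_left _ _ _
      · rw [equivX_one_iff] at huv ⊢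
        exact fun l hl => ⟨sublist_flatMap_of_forall h (fun l hl => (huv l hl).1) hl,
          sublist_flatMap_of_forall h (fun l hl => (huv l hl).2) hl⟩
    obtain ⟨m, rfl⟩ : ∃ k, m = k + 1 := ⟨m - 1, by omega⟩
    refine equivX_succ_of (fun m' hm' => ⟨ih h (huv.lower hm').1, ihY (huv.lower hm').2⟩)
      fun _ hmn a => ?_
    have hmem := huv.mem_iff (by omega) hmn
    refine ⟨by simp [hmem], fun u₁ u₂ v₁ v₂ hu hu₁ hv hv₁ => ?_⟩
    -- the first `a` of `h(u)` lies in the image of the first letter `b` of `u` with `a` in `h(b)`,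
    -- and that letter is the same for `v`
    have split : ∀ w w₁ w₂ : List A, ∀ b : A, ∀ z₁ z₂ : List B, w = w₁ ++ b :: w₂ → a ∈ h b →
        (∀ c ∈ w₁, a ∉ h c) → w.flatMap h = z₁ ++ a :: z₂ → a ∉ z₁ →
        ∃ x y, h b = x ++ a :: y ∧ a ∉ x ∧ z₁ = w₁.flatMap h ++ x ∧ z₂ = y ++ w₂.flatMap h := by
      rintro w w₁ w₂ b z₁ z₂ rfl hb hw hz hz₁
      obtain ⟨x, y, hxy, hx⟩ := List.eq_append_cons_of_mem hb
      refine ⟨x, y, hxy, hx, ?_⟩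
      have e : (w₁.flatMap h ++ x) ++ a :: (y ++ w₂.flatMap h) = z₁ ++ a :: z₂ := by
        rw [← hz, List.flatMap_append, List.flatMap_cons, hxy]
        simp
      have := append_cons_inj_of_notMem e (by simpa [hx] using hw) hz₁
      exact ⟨this.1.symm, this.2.symm⟩
    have hau : ∃ b ∈ u, a ∈ h b := List.mem_flatMap.1 (hu ▸ by simp)
    have hav : ∃ b ∈ v, a ∈ h b := List.mem_flatMap.1 (hv ▸ by simp)
    obtain ⟨p, b, s, rfl, hb, hp⟩ := exists_first hau
    obtain ⟨p', b', s', rfl, hb', hp'⟩ := exists_first hav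
    obtain rfl := huv.first_eq hm hmn hb hb' hp hp'
    obtain ⟨x, y, hxy, hx, rfl, rfl⟩ := split _ p s b u₁ u₂ rfl hb hp hu hu₁
    obtain ⟨x', y', hxy', hx', rfl, rfl⟩ := split _ p' s' b v₁ v₂ rfl hb' hp' hv hv₁
    obtain ⟨rfl, rfl⟩ := append_cons_inj_of_notMem (hxy.symm.trans hxy') hx hx'
    have hbp : b ∉ p := fun h => hp b h hb
    have hbp' : b ∉ p' := fun h => hp' b h hb'
    exact ⟨(EquivX.refl _ _ _).append_append (ih h (huv.right hbp hbp')),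
      (ihY (huv.left hbp hbp')).append_append (EquivY.refl _ _ _)⟩

lemma EquivY.flatMap {B : Type} {m n : ℕ} {u v : List A} (h : A → List B) (huv : EquivY m n u v) :
    EquivY m n (u.flatMap h) (v.flatMap h) := by
  rw [← equivX_reverse] at huv ⊢
  rw [List.reverse_flatMap, List.reverse_flatMap]
  exact huv.flatMap _


/-! ### Pseudovarieties and languages defined by stable families of congruences -/

/-- A descending sequence of finite-index congruences on each free monoid, compatible with
substitutions. -/
structure IsStableFamily (E : ∀ A : Type, ℕ → List A → List A → Prop) : Prop where
  refl : ∀ (A : Type) (n : ℕ) (u : List A), E A n u u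
  symm : ∀ (A : Type) (n : ℕ) (u v : List A), E A n u v → E A n v u
  trans : ∀ (A : Type) (n : ℕ) (u v w : List A), E A n u v → E A n v w → E A n u w
  append : ∀ (A : Type) (n : ℕ) (u v u' v' : List A), E A n u v → E A n u' v' →
    E A n (u ++ u') (v ++ v')
  mono : ∀ (A : Type) (n n' : ℕ) (u v : List A), E A n u v → n' ≤ n → E A n' u v
  flatMap : ∀ (A B : Type) (n : ℕ) (h : A → List B) (u v : List A), E A n u v →
    E B n (u.flatMap h) (v.flatMap h)
  finite : ∀ (A : Type) [Finite A] (n : ℕ), ∃ (κ : Type) (_ : Finite κ) (f : List A → κ),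
    ∀ u v, f u = f v → E A n u v

namespace IsStableFamily

variable {E : ∀ A : Type, ℕ → List A → List A → Prop}

/-- The members of the family, as congruences of the free monoid. -/
def con (hE : IsStableFamily E) (A : Type) (n : ℕ) : Con (FreeMonoid A) where
  r u v := E A n u.toList v.toList
  iseqv := ⟨fun _ => hE.refl _ _ _, fun h => hE.symm _ _ _ _ h, fun h h' => hE.trans _ _ _ _ _ h h'⟩
  mul' h h' := hE.append _ _ _ _ _ _ h h'

lemma finite_quotient (hE : IsStableFamily E) {A : Type} [Finite A] {n : ℕ} (c : Con (FreeMonoid A))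
    (hc : ∀ u v, E A n u.toList v.toList → c u v) : Finite c.Quotient := by
  obtain ⟨κ, _, f, hf⟩ := hE.finite A n
  refine Finite.of_injective (fun q : c.Quotient => f (Quotient.out q).toList) fun q q' h => ?_
  rw [← Quotient.out_eq q, ← Quotient.out_eq q']
  exact Quotient.sound (hc _ _ (hf _ _ h))

/-- Compatibility with substitutions carries the condition on words over `M` to every alphabet. -/
lemma map_eq (hE : IsStableFamily E) {M : Type} [Monoid M] {n : ℕ}
    (hM : ∀ u v : List M, E M n u v → u.prod = v.prod) {A : Type} (φ : FreeMonoid A →* M)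
    {u v : FreeMonoid A} (h : E A n u.toList v.toList) :
    φ u = φ v := by
  rw [← FreeMonoid.lift_restrict φ, FreeMonoid.lift_apply, FreeMonoid.lift_apply]
  refine hM _ _ ?_
  rw [List.map_eq_flatMap, List.map_eq_flatMap]
  exact hE.flatMap _ _ _ _ _ _ h

/-- A finite monoid satisfies one of the congruences of the family, when words over the monoid
itself are evaluated. -/
def Sat (E : ∀ A : Type, ℕ → List A → List A → Prop) (M : Type) [Monoid M] : Prop :=
  Finite M ∧ ∃ n, ∀ u v : List M, E M n u v → u.prod = v.prod

lemma sat_of_surjective (hE : IsStableFamily E) {A : Type} {M : Type} [Monoid M] [Finite M]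
    (φ : FreeMonoid A →* M) (hφ : Function.Surjective φ) {n : ℕ}
    (h : ∀ u v : FreeMonoid A, E A n u.toList v.toList → φ u = φ v) : Sat E M := by
  refine ⟨inferInstance, n, fun u v huv => ?_⟩
  choose g hg using hφ
  have key : ∀ u : List M, φ (FreeMonoid.ofList (u.flatMap fun x => (g x).toList)) = u.prod := by
    intro u
    induction u with
    | nil => exact map_one φ
    | cons x u ih =>
      rw [List.flatMap_cons, FreeMonoid.ofList_append, map_mul, ih, List.prod_cons,
        FreeMonoid.ofList_toList, hg]
  rw [← key u, ← key v]
  exact h _ _ (hE.flatMap _ _ _ _ _ _ huv)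

lemma sat_quotient (hE : IsStableFamily E) {A : Type} [Finite A] {n : ℕ} (c : Con (FreeMonoid A))
    (hc : ∀ u v, E A n u.toList v.toList → c u v) : Sat E c.Quotient := by
  have := hE.finite_quotient c hc
  exact hE.sat_of_surjective c.mk' Con.mk'_surjective
    fun u v h => (Con.eq c).2 (hc u v h)

lemma isPseudovariety_sat (hE : IsStableFamily E) : IsPseudovariety (fun M _ => Sat E M) where
  finite M _ h := h.1
  prod ι _ M _ h := by
    have : ∀ i, Finite (M i) := fun i => (h i).1
    choose n hn using fun i => (h i).2
    obtain ⟨N, hN⟩ := Finite.exists_le n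
    refine ⟨inferInstance, N, fun u v huv => ?_⟩
    ext i
    have := hE.map_eq (hn i) ((Pi.evalMonoidHom M i).comp (FreeMonoid.lift id))
      (u := FreeMonoid.ofList u) (v := FreeMonoid.ofList v) (hE.mono _ _ _ _ _ huv (hN i))
    simpa [FreeMonoid.lift_apply] using this
  image M N _ _ f hf h := by
    obtain ⟨hM, n, hn⟩ := h
    have := Finite.of_surjective f hf
    refine ⟨this, n, fun u v huv => ?_⟩
    choose g hg using hf
    have := congrArg f (hE.map_eq hn (FreeMonoid.lift g)
      (u := FreeMonoid.ofList u) (v := FreeMonoid.ofList v) huv)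
    rw [FreeMonoid.hom_map_lift, FreeMonoid.hom_map_lift] at this
    have e : f ∘ g = id := funext hg
    simpa [e, FreeMonoid.lift_apply] using this
  sub M _ S h := by
    obtain ⟨hM, n, hn⟩ := h
    refine ⟨inferInstance, n, fun u v huv => ?_⟩
    have := hE.map_eq hn (S.subtype.comp (FreeMonoid.lift id))
      (u := FreeMonoid.ofList u) (v := FreeMonoid.ofList v) huv
    simp only [MonoidHom.comp_apply] at this
    simpa [FreeMonoid.lift_apply] using S.subtype_injective this

/-- The pseudovariety generated by the quotients of finitely generated free monoids by a stable
family of congruences. -/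
theorem generated_iff (hE : IsStableFamily E) (m : ℕ) (M : Type) [Monoid M] :
    generatedPseudovariety (fun M _ =>
      ∃ (A : Type) (_ : Finite A) (n : ℕ) (c : Con (FreeMonoid A)), m ≤ n ∧
        (∀ u v : FreeMonoid A, c u v ↔ E A n u.toList v.toList) ∧ Nonempty (M ≃* c.Quotient)) M ↔
      Sat E M := by
  constructor
  · refine fun h => h (fun M _ => Sat E M) hE.isPseudovariety_sat ?_
    rintro N _ ⟨A, _, n, c, -, hc, ⟨e⟩⟩
    exact hE.isPseudovariety_sat.image _ _ e.symm.toMonoidHom e.symm.surjective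
      (hE.sat_quotient (n := n) c fun u v => (hc u v).2)
  · rintro ⟨_, n, hn⟩ V hV hG
    have hle : hE.con M (max m n) ≤ Con.ker (FreeMonoid.lift (id : M → M)) := fun u v h =>
      hE.map_eq hn _ (hE.mono _ _ _ _ _ h (le_max_right _ _))
    exact hV.image _ _ ((hE.con M (max m n)).lift (FreeMonoid.lift id) hle)
      (Con.lift_surjective_of_surjective hle fun x => ⟨FreeMonoid.of x, by simp⟩)
      (hG _ ⟨M, inferInstance, max m n, hE.con M (max m n), le_max_left _ _, fun _ _ => Iff.rfl,
        ⟨MulEquiv.refl _⟩⟩)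

lemma mem_languagesOf_sat_iff (hE : IsStableFamily E) (A : Type) [Finite A] (L : Language A) :
    L ∈ languagesOf (fun M _ => Sat E M) A ↔
      ∃ n, ∀ u v : List A, E A n u v → (u ∈ L ↔ v ∈ L) := by
  constructor
  · rintro ⟨M, _, ⟨_, n, hn⟩, φ, hφ⟩
    refine ⟨n, fun u v huv => ?_⟩
    have := hE.map_eq hn φ (u := FreeMonoid.ofList u) (v := FreeMonoid.ofList v) huv
    rw [hφ u, hφ v, this]
  · rintro ⟨n, hn⟩
    refine ⟨(hE.con A n).Quotient, inferInstance, hE.sat_quotient _ fun _ _ h => h,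
      (hE.con A n).mk', fun w => ⟨fun h => ⟨w, h, rfl⟩, ?_⟩⟩
    rintro ⟨w', hw', h⟩
    exact (hn _ _ ((Con.eq _).1 h)).2 hw'

end IsStableFamily

/-! ### The pseudovarieties `R_m` and `L_m` -/

instance {A : Type} [Finite A] : Finite (RankerLetter A) :=
  Finite.of_injective (β := A × Bool)
    (fun Z => match Z with
      | .X a => (a, true)
      | .Y a => (a, false))
    (by rintro (a | a) (b | b) h <;> simp_all)

lemma isStableFamily_equivX (m : ℕ) : IsStableFamily fun _ n => EquivX m n where
  refl _ _ _ := .refl _ _ _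
  symm _ _ _ _ h := h.symm
  trans _ _ _ _ _ h h' := h.trans h'
  append _ _ _ _ _ _ h h' := h.append_append h'
  mono _ _ _ _ _ h hn := h.mono hn
  flatMap _ _ _ h _ _ huv := huv.flatMap h
  finite A _ n := by
    have := (List.finite_length_le (RankerLetter A) n).to_subtype
    refine ⟨Set {r : List (RankerLetter A) | r.length ≤ n}, inferInstance,
      fun u => {r | Cond r.1 u}, fun u v h => ?_⟩
    have h' : ∀ r : List (RankerLetter A), r.length ≤ n → (Cond r u ↔ Cond r v) :=
      fun r hr => Set.ext_iff.1 h ⟨r, hr⟩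
    exact equivX_iff.2 ⟨fun a r _ h2 => h' _ h2, fun r _ h2 => h' _ h2.le⟩

lemma isStableFamily_equivY (m : ℕ) : IsStableFamily fun _ n => EquivY m n where
  refl _ _ _ := .refl _ _ _
  symm _ _ _ _ h := h.symm
  trans _ _ _ _ _ h h' := h.trans h'
  append _ _ _ _ _ _ h h' := h.append_append h'
  mono _ _ _ _ _ h hn := h.mono hn
  flatMap _ _ _ h _ _ huv := huv.flatMap h
  finite A _ n := by
    obtain ⟨κ, hκ, f, hf⟩ := (isStableFamily_equivX m).finite A n
    exact ⟨κ, hκ, fun u => f u.reverse, fun u v h => equivX_reverse.1 (hf _ _ h)⟩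

theorem pvR_iff (m : ℕ) (M : Type) [Monoid M] :
    pvR m M ↔ Finite M ∧ ∃ n, ∀ u v : List M, EquivX m n u v → u.prod = v.prod :=
  (isStableFamily_equivX m).generated_iff m M

theorem pvL_iff (m : ℕ) (M : Type) [Monoid M] :
    pvL m M ↔ Finite M ∧ ∃ n, ∀ u v : List M, EquivY m n u v → u.prod = v.prod :=
  (isStableFamily_equivY m).generated_iff m M

theorem mem_langR_iff (m : ℕ) (A : Type) [Finite A] (L : Language A) :
    L ∈ langR m A ↔ ∃ n, ∀ u v : List A, EquivX m n u v → (u ∈ L ↔ v ∈ L) := by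
  rw [← (isStableFamily_equivX m).mem_languagesOf_sat_iff]
  refine exists_congr fun M => exists_congr fun _ => and_congr (pvR_iff m M) Iff.rfl

theorem mem_langL_iff (m : ℕ) (A : Type) [Finite A] (L : Language A) :
    L ∈ langL m A ↔ ∃ n, ∀ u v : List A, EquivY m n u v → (u ∈ L ↔ v ∈ L) := by
  rw [← (isStableFamily_equivY m).mem_languagesOf_sat_iff]
  refine exists_congr fun M => exists_congr fun _ => and_congr (pvL_iff m M) Iff.rfl


/-! ### Powers of words -/

/-- The power `x^p` of a word. -/
def wordPow {A : Type} (p : ℕ) (x : List A) : List A := (List.replicate p x).flatten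

section wordPow

lemma wordPow_succ (p : ℕ) (x : List A) : wordPow (p + 1) x = x ++ wordPow p x := by
  simp [wordPow, List.replicate_succ]

lemma wordPow_succ' (p : ℕ) (x : List A) : wordPow (p + 1) x = wordPow p x ++ x := by
  simp [wordPow, List.replicate_succ']

lemma mem_wordPow {p : ℕ} {x : List A} {a : A} (h : a ∈ wordPow p x) : a ∈ x := by
  obtain ⟨l, hl, ha⟩ := List.mem_flatten.1 h
  rwa [List.eq_of_mem_replicate hl] at ha

lemma prod_wordPow {M : Type} [Monoid M] (p : ℕ) (x : List M) :
    (wordPow p x).prod = x.prod ^ p := by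
  simp [wordPow, List.prod_flatten]

lemma map_wordPow_of_idempotent {M : Type} [Monoid M] (φ : FreeMonoid A →* M) {e : FreeMonoid A}
    (he : φ e * φ e = φ e) (p : ℕ) :
    φ (FreeMonoid.ofList (wordPow (p + 1) e.toList)) = φ e := by
  induction p with
  | zero => simp [wordPow]
  | succ p ih => rw [wordPow_succ, FreeMonoid.ofList_append, map_mul, ih, FreeMonoid.ofList_toList,
      he]

lemma sublist_wordPow {x l : List A} (h : ∀ a ∈ l, a ∈ x) {n : ℕ} (hn : l.length ≤ n) :
    List.Sublist l (wordPow n x) := by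
  induction n generalizing l with
  | zero => simp [List.length_eq_zero_iff.1 (Nat.le_zero.1 hn)]
  | succ n ih =>
    rcases l with _ | ⟨a, l⟩
    · simp
    · rw [wordPow_succ, ← List.singleton_append]
      exact (List.singleton_sublist.2 (h a List.mem_cons_self)).append
        (ih (fun b hb => h b (List.mem_cons_of_mem _ hb)) (by simpa using hn))

/-- A ranker of depth at most `p` does not see a word that is inserted between two powers `x^p` and
uses only letters of `x`: the run consumes at most one factor `x` per letter of the ranker. -/
lemma cond_insert {x u v : List A} (hu : ∀ a ∈ u, a ∈ x) (hv : ∀ a ∈ v, a ∈ x)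
    (r : List (RankerLetter A)) : ∀ (p : ℕ) (s t : List A), r.length ≤ p →
      (Cond r (s ++ wordPow p x ++ u ++ wordPow p x ++ t) ↔
        Cond r (s ++ wordPow p x ++ v ++ wordPow p x ++ t)) := by
  induction r with
  | nil => simp [Cond]
  | cons Z r ih =>
    intro p s t hp
    have hp' : r.length ≤ p := Nat.le_of_succ_le hp
    obtain ⟨q, rfl⟩ : ∃ q, p = q + 1 := ⟨p - 1, by simp at hp; omega⟩
    have hq : r.length ≤ q := by simpa using hp
    have hnext : ∀ P S P' S' : List A, (Cond r P ↔ Cond r P') → (Cond r S ↔ Cond r S') →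
        (Cond r (nextPart r P S) ↔ Cond r (nextPart r P' S')) := by
      intro P S P' S' h1 h2
      rcases r with _ | ⟨_ | _, r⟩
      exacts [h1, h2, h1]
    cases Z with
    | X a =>
      by_cases has : a ∈ s
      · obtain ⟨s₁, s₂, rfl, hs⟩ := List.eq_append_cons_of_mem has
        simp only [List.append_assoc, List.cons_append]
        rw [cond_X_of_split hs, cond_X_of_split hs]
        exact hnext _ _ _ _ Iff.rfl (by simpa using ih (q + 1) s₂ t hp')
      by_cases hax : a ∈ x
      · obtain ⟨x₁, x₂, hx, hx₁⟩ := List.eq_append_cons_of_mem hax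
        have e : ∀ w : List A, s ++ wordPow (q + 1) x ++ w ++ wordPow (q + 1) x ++ t =
            (s ++ x₁) ++ a :: (x₂ ++ wordPow q x ++ w ++ wordPow q x ++ (x ++ t)) := by
          intro w
          nth_rw 1 [wordPow_succ]
          nth_rw 1 [wordPow_succ']
          nth_rw 1 [hx]
          simp
        have hsx : a ∉ s ++ x₁ := by simp [has, hx₁]
        rw [e, e, cond_X_of_split hsx, cond_X_of_split hsx]
        exact hnext _ _ _ _ Iff.rfl (ih q x₂ (x ++ t) hq)
      by_cases hat : a ∈ t
      · obtain ⟨t₁, t₂, rfl, ht⟩ := List.eq_append_cons_of_mem hat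
        have hn : ∀ w : List A, (∀ b ∈ w, b ∈ x) →
            a ∉ s ++ wordPow (q + 1) x ++ w ++ wordPow (q + 1) x ++ t₁ := by
          intro w hw h
          simp only [List.mem_append, has, ht, false_or, or_false] at h
          rcases h with (h | h) | h
          exacts [hax (mem_wordPow h), hax (hw a h), hax (mem_wordPow h)]
        rw [← List.append_assoc, ← List.append_assoc, cond_X_of_split (hn u hu),
          cond_X_of_split (hn v hv)]
        exact hnext _ _ _ _ (ih (q + 1) s t₁ hp') Iff.rfl
      · have hn : ∀ w : List A, (∀ b ∈ w, b ∈ x) →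
            a ∉ s ++ wordPow (q + 1) x ++ w ++ wordPow (q + 1) x ++ t := by
          intro w hw h
          simp only [List.mem_append, has, hat, false_or, or_false] at h
          rcases h with (h | h) | h
          exacts [hax (mem_wordPow h), hax (hw a h), hax (mem_wordPow h)]
        exact iff_of_false (fun h => hn u hu h.mem_X) fun h => hn v hv h.mem_X
    | Y a =>
      by_cases hat : a ∈ t
      · obtain ⟨t₁, t₂, rfl, ht⟩ := exists_split_last hat
        rw [← List.append_assoc, ← List.append_assoc, cond_Y_of_split ht, cond_Y_of_split ht]
        exact hnext _ _ _ _ (ih (q + 1) s t₁ hp') Iff.rfl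
      by_cases hax : a ∈ x
      · obtain ⟨x₁, x₂, hx, hx₂⟩ := exists_split_last hax
        have e : ∀ w : List A, s ++ wordPow (q + 1) x ++ w ++ wordPow (q + 1) x ++ t =
            ((s ++ x) ++ wordPow q x ++ w ++ wordPow q x ++ x₁) ++ a :: (x₂ ++ t) := by
          intro w
          nth_rw 1 [wordPow_succ]
          nth_rw 1 [wordPow_succ']
          nth_rw 4 [hx]
          simp
        have hxt : a ∉ x₂ ++ t := by simp [hat, hx₂]
        rw [e, e, cond_Y_of_split hxt, cond_Y_of_split hxt]
        exact hnext _ _ _ _ (ih q (s ++ x) x₁ hq) Iff.rfl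
      by_cases has : a ∈ s
      · obtain ⟨s₁, s₂, rfl, hs⟩ := exists_split_last has
        have hn : ∀ w : List A, (∀ b ∈ w, b ∈ x) →
            a ∉ s₂ ++ (wordPow (q + 1) x ++ (w ++ (wordPow (q + 1) x ++ t))) := by
          intro w hw h
          simp only [List.mem_append, hs, hat, false_or, or_false] at h
          rcases h with h | h | h
          exacts [hax (mem_wordPow h), hax (hw a h), hax (mem_wordPow h)]
        simp only [List.append_assoc, List.cons_append]
        rw [cond_Y_of_split (hn u hu), cond_Y_of_split (hn v hv)]
        exact hnext _ _ _ _ Iff.rfl (by simpa using ih (q + 1) s₂ t hp')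
      · have hn : ∀ w : List A, (∀ b ∈ w, b ∈ x) →
            a ∉ s ++ wordPow (q + 1) x ++ w ++ wordPow (q + 1) x ++ t := by
          intro w hw h
          simp only [List.mem_append, has, hat, false_or, or_false] at h
          rcases h with (h | h) | h
          exacts [hax (mem_wordPow h), hax (hw a h), hax (mem_wordPow h)]
        exact iff_of_false (fun h => hn u hu h.mem_Y) fun h => hn v hv h.mem_Y

/-- A ranker that starts with an `X`-letter does not see a word which is appended to a large power
`e^p` and uses only letters of `e`. -/
lemma cond_X_wordPow_append {e y : List A} (hy : ∀ a ∈ y, a ∈ e) (r : List (RankerLetter A)) :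
    ∀ (a : A) (p : ℕ) (s : List A), r.length + 1 ≤ p →
      (Cond (.X a :: r) (s ++ wordPow p e ++ y) ↔ Cond (.X a :: r) (s ++ wordPow p e)) := by
  induction r with
  | nil =>
    intro a p s hp
    obtain ⟨q, rfl⟩ : ∃ q, p = q + 1 := ⟨p - 1, by simp at hp; omega⟩
    rw [cond_singleton_X, cond_singleton_X, List.mem_append, or_iff_left_iff_imp]
    intro h
    simp [wordPow_succ, hy a h]
  | cons Z r ih =>
    intro a p s hp
    obtain ⟨q, rfl⟩ : ∃ q, p = q + 1 := ⟨p - 1, by simp at hp; omega⟩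
    by_cases has : a ∈ s
    · obtain ⟨s₁, s₂, rfl, hs⟩ := List.eq_append_cons_of_mem has
      simp only [List.append_assoc, List.cons_append]
      rw [cond_X_of_split hs, cond_X_of_split hs]
      cases Z with
      | X b => simpa using ih b (q + 1) s₂ (by simp at hp ⊢; omega)
      | Y b => rfl
    by_cases hae : a ∈ e
    · obtain ⟨e₁, e₂, he, he₁⟩ := List.eq_append_cons_of_mem hae
      have hs : a ∉ s ++ e₁ := by simp [has, he₁]
      have e1 : s ++ wordPow (q + 1) e = (s ++ e₁) ++ a :: (e₂ ++ wordPow q e) := by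
        rw [wordPow_succ]
        nth_rw 1 [he]
        simp
      rw [e1, List.append_assoc (s ++ e₁), List.cons_append, cond_X_of_split hs,
        cond_X_of_split hs]
      cases Z with
      | X b => simpa using ih b q e₂ (by simpa using hp)
      | Y b => rfl
    · refine iff_of_false (fun h => ?_) fun h => ?_
      · have := h.mem_X
        simp only [List.mem_append, has, false_or] at this
        rcases this with h | h
        exacts [hae (mem_wordPow h), hae (hy a h)]
      · have := h.mem_X
        simp only [List.mem_append, has, false_or] at this
        exact hae (mem_wordPow this)

/-- If `e` is idempotent modulo `◁_{m,n}` and `y` is equivalent to `e`, then a large power of `e`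
absorbs `y` on its right modulo `▷_{m+1,n}`. -/
lemma equivX_wordPow_append {m n : ℕ} {e y : List A} (hm : 1 ≤ m) (hn : m ≤ n)
    (hee : EquivY m n (e ++ e) e) (hy : EquivY m n y e) :
    EquivX (m + 1) n (wordPow (n + 1) e ++ y) (wordPow (n + 1) e) := by
  have hsub : ∀ a ∈ y, a ∈ e := fun a => (hy.mem_iff hm hn a).1
  have hX : ∀ a (r : List (RankerLetter A)), r.length + 1 ≤ n →
      (Cond (.X a :: r) (wordPow (n + 1) e ++ y) ↔ Cond (.X a :: r) (wordPow (n + 1) e)) :=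
    fun a r hr => by simpa using cond_X_wordPow_append hsub r a (n + 1) [] (by omega)
  have hY : EquivY m n (wordPow (n + 1) e ++ y) (wordPow (n + 1) e) := by
    refine ((EquivY.refl m n (wordPow (n + 1) e)).append_append hy).trans ?_
    rw [wordPow_succ', List.append_assoc]
    exact (EquivY.refl _ _ _).append_append hee
  refine equivX_iff.2 ⟨fun a r _ h => hX a r h, fun r hb hl => ?_⟩
  rcases r with _ | ⟨a | a, r⟩
  · simp [Cond]
  · exact hX a r (by simpa using hl.le)
  · rw [equivY_iff] at hY
    obtain h | h := (Nat.lt_succ_iff.1 hb).eq_or_lt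
    · exact hY.1 a r h (by simpa using hl.le)
    · exact hY.2 _ h hl

end wordPow

/-! ### Idempotents -/

lemma exists_pow_isIdempotentElem {M : Type} [Monoid M] [Finite M] (g : M) :
    ∃ k, IsIdempotentElem (g ^ (k + 1)) := by
  obtain ⟨i, j, hij, h⟩ := Set.infinite_univ.exists_lt_map_eq_of_mapsTo
    (f := fun i : ℕ => g ^ i) (t := Set.univ) (fun _ _ => trivial) (Set.toFinite _)
    |>.imp fun i h => h.2.imp fun j h => h.2
  obtain ⟨d, rfl⟩ : ∃ d, j = i + (d + 1) := ⟨j - i - 1, by omega⟩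
  have h1 : ∀ k, g ^ (i + k) = g ^ (i + k + (d + 1)) := fun k => by
    rw [pow_add, h, ← pow_add]
    congr 1
    omega
  have h2 : ∀ l k, g ^ (i + k) = g ^ (i + k + l * (d + 1)) := by
    intro l
    induction l with
    | zero => simp
    | succ l ih =>
      intro k
      rw [ih k, add_assoc, h1, add_one_mul]
      congr 1
      omega
  refine ⟨(i + 1) * (d + 1) - 1, ?_⟩
  have hpos : 0 < (i + 1) * (d + 1) := by positivity
  have hle : i ≤ (i + 1) * (d + 1) := by nlinarith
  have h3 := h2 (i + 1) ((i + 1) * (d + 1) - i)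
  rw [show i + ((i + 1) * (d + 1) - i) = (i + 1) * (d + 1) by omega] at h3
  rw [Nat.sub_add_cancel hpos, IsIdempotentElem, ← pow_add, ← h3]

/-- The members of `L_m` satisfy the identity that defines the pseudovariety `DA`: an idempotent `f`
absorbs each of its factors. -/
lemma pvL.idempotent_absorbs {m : ℕ} {N : Type} [Monoid N] (hN : pvL m N) {f b z₁ z₂ : N}
    (hf : f * f = f) (h : f = z₁ * b * z₂) : f * b * f = f := by
  obtain ⟨_, n, hn⟩ := (pvL_iff m N).1 hN
  have key : EquivY m n (wordPow (n + 1) [z₁, b, z₂] ++ [b] ++ wordPow (n + 1) [z₁, b, z₂])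
      (wordPow (n + 1) [z₁, b, z₂] ++ [] ++ wordPow (n + 1) [z₁, b, z₂]) := by
    have hc : ∀ r : List (RankerLetter N), r.length ≤ n → _ := fun r hr =>
      cond_insert (x := [z₁, b, z₂]) (u := [b]) (v := []) (by simp) (by simp) r (n + 1) [] []
        (by omega)
    simp only [List.nil_append, List.append_nil] at hc
    rw [List.append_nil, equivY_iff]
    exact ⟨fun a r _ h => hc _ h, fun r _ h => hc r h.le⟩
  have hp : ([z₁, b, z₂] : List N).prod ^ (n + 1) = f := by
    have : ([z₁, b, z₂] : List N).prod = f := by simp [h, mul_assoc]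
    rw [this]
    exact IsIdempotentElem.pow_succ_eq n hf
  have := hn _ _ key
  simpa only [List.prod_append, prod_wordPow, hp, List.prod_nil, mul_one, List.prod_singleton, hf]
    using this

/-! ### Mal'cev products with `K` -/

/-- An idempotent of a semigroup is its own `ω`-power. -/
lemma pvK_iff {S : Type} [Semigroup S] :
    pvK S ↔ Finite S ∧ ∀ e y : S, IsIdempotentElem e → e * y = e :=
  and_congr_right fun _ => ⟨fun h e y he => h e y e ⟨Subsemigroup.mem_closure_of_mem rfl, he⟩,
    fun h _ y e he => h e y he.2⟩

lemma malcev_pvK_iff {W : MonoidClass} {M : Type} [Monoid M] :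
    malcev pvK W M ↔ ∃ (T N : Type) (_ : Monoid T) (_ : Monoid N) (α : T →* M) (β : T →* N),
      Finite T ∧ Function.Surjective α ∧ Function.Surjective β ∧ W N ∧
      ∀ e y : T, e * e = e → β y = β e → e * y = e := by
  refine exists_congr fun T => exists_congr fun N => exists_congr fun _ => exists_congr fun _ =>
    exists_congr fun α => exists_congr fun β => and_congr_right fun hT => and_congr_right fun _ =>
    and_congr_right fun _ => and_congr_right fun _ => ?_
  constructor
  · intro h e y he hy
    have hβ : IsIdempotentElem (β e) := by rw [IsIdempotentElem, ← map_mul, he]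
    exact congrArg Subtype.val ((pvK_iff.1 (h _ hβ)).2 ⟨e, rfl⟩ ⟨y, hy⟩ (Subtype.ext he))
  · intro h f hf
    refine pvK_iff.2 ⟨Subtype.finite, fun e y he => Subtype.ext ?_⟩
    exact h e.1 y.1 (congrArg Subtype.val he) (y.2.trans e.2.symm)

lemma malcev_image {V : SemigroupClass} {W : MonoidClass} {M M' : Type} [Monoid M] [Monoid M']
    (f : M →* M') (hf : Function.Surjective f) (h : malcev V W M) : malcev V W M' := by
  obtain ⟨T, N, _, _, α, β, h1, h2, h3⟩ := h
  exact ⟨T, N, _, _, f.comp α, β, h1, hf.comp h2, h3⟩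

/-- A criterion for membership in a Mal'cev product with `K`, for a finite quotient of a free
monoid: the monoid `T` of the definition is the joint quotient by the two congruences. -/
lemma malcev_pvK_of_con {W : MonoidClass} {A M : Type} [Monoid M] [Finite M]
    (φ : FreeMonoid A →* M) (hφ : Function.Surjective φ) (c : Con (FreeMonoid A))
    [Finite c.Quotient] (hW : W c.Quotient)
    (h : ∀ e y, φ e * φ e = φ e → c (e * e) e → c y e → φ e * φ y = φ e) : malcev pvK W M := by
  have hα : Con.ker φ ⊓ c ≤ Con.ker φ := inf_le_left
  have hβ : Con.ker φ ⊓ c ≤ Con.ker c.mk' := by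
    rw [Con.mk'_ker]
    exact inf_le_right
  refine malcev_pvK_iff.2 ⟨(Con.ker φ ⊓ c).Quotient, c.Quotient, inferInstance, inferInstance,
    (Con.ker φ ⊓ c).lift φ hα, (Con.ker φ ⊓ c).lift c.mk' hβ, ?_,
    Con.lift_surjective_of_surjective _ hφ,
    Con.lift_surjective_of_surjective _ Con.mk'_surjective, hW, ?_⟩
  · refine Finite.of_injective (β := M × c.Quotient)
      (fun t => ((Con.ker φ ⊓ c).lift φ hα t, (Con.ker φ ⊓ c).lift c.mk' hβ t)) fun t t' ht => ?_
    induction t, t' using Con.induction_on₂ with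
    | _ t t' =>
      simp only [Con.lift_coe, Prod.mk.injEq, Con.coe_mk', Con.eq] at ht
      exact (Con.eq _).2 ht
  · intro e y
    induction e, y using Con.induction_on₂ with
    | _ e y =>
      simp only [Con.lift_coe, Con.coe_mk', ← Con.coe_mul, Con.eq]
      intro he hy
      have he1 : φ (e * e) = φ e := he.1
      have he2 : c (e * e) e := he.2
      refine ⟨?_, c.trans (c.mul (c.refl e) hy) he2⟩
      rw [map_mul] at he1
      change φ (e * y) = φ e
      rw [map_mul]
      exact h e y he1 he2 hy

/-- `R_{m+1}` is contained in the Mal'cev product of `K` and `L_m`. -/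
theorem malcev_of_pvR_succ {m : ℕ} (hm : 1 ≤ m) {M : Type} [Monoid M] (h : pvR (m + 1) M) :
    malcev pvK (pvL m) M := by
  obtain ⟨_, n, hn⟩ := (pvR_iff _ M).1 h
  set k := max n m with hk
  have hX := isStableFamily_equivX (m + 1)
  have hY := isStableFamily_equivY m
  have hle : hX.con M k ≤ Con.ker (FreeMonoid.lift (id : M → M)) := fun u v h =>
    hX.map_eq hn _ (EquivX.mono h (le_max_left n m))
  have : Finite (hX.con M k).Quotient := hX.finite_quotient _ fun _ _ h => h
  have : Finite (hY.con M k).Quotient := hY.finite_quotient _ fun _ _ h => h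
  refine malcev_image ((hX.con M k).lift _ hle)
    (Con.lift_surjective_of_surjective hle fun x => ⟨FreeMonoid.of x, by simp⟩)
    (malcev_pvK_of_con (hX.con M k).mk' Con.mk'_surjective (hY.con M k)
      ((pvL_iff _ _).2 (hY.sat_quotient _ fun _ _ h => h)) fun e y he hee hye => ?_)
  rw [← map_wordPow_of_idempotent _ he k, ← map_mul]
  exact (Con.eq _).2 (equivX_wordPow_append hm (le_max_right n m) hee hye)

/-! ### From the Mal'cev product to rankers -/

section Descent

variable {T N : Type} [Monoid T] [Monoid N] [Finite T]

/-- If `s * p` is in the `R`-class of `s`, then `s * p` is determined by `s` and the image of `p` in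
`N`.  Indeed `s * p` is fixed by an idempotent power of `x * p`, which absorbs on its right the
elements with the same image, among them a multiple `(x * p) ^ k * (x * q)`. -/
lemma mul_eq_mul_of_fiber (β : T →* N)
    (hK : ∀ e y : T, e * e = e → β y = β e → e * y = e) {s p q x : T} (hs : s * p * x = s)
    (hpq : β p = β q) : s * p = s * q := by
  obtain ⟨k, hk⟩ := exists_pow_isIdempotentElem (x * p)
  have h1 : ∀ k, s * p * (x * p) ^ k = s * p := by
    intro k
    induction k with
    | zero => simp
    | succ k ih => rw [pow_succ, ← mul_assoc, ih, ← mul_assoc, hs]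
  have h2 := hK _ ((x * p) ^ k * (x * q)) hk (by simp [hpq, pow_succ])
  calc s * p = s * p * ((x * p) ^ (k + 1) * ((x * p) ^ k * (x * q))) := by rw [h2, h1]
    _ = s * p * (x * p) ^ (k + 1) * (x * p) ^ k * x * q := by simp only [mul_assoc]
    _ = s * q := by rw [h1, h1, hs]

/-- If one element of the `R`-class of `s` stays in the class when multiplied by `b`, so do all. -/
lemma greenR_mul_of_greenR_mul
    (hDA : ∀ f b z₁ z₂ : T, f * f = f → f = z₁ * b * z₂ → f * b * f = f) {s p b z s' : T}
    (h : s * p * b * z = s) (hs' : GreenR s s') : GreenR s (s' * b) := by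
  obtain ⟨⟨c', hc'⟩, c, hc⟩ := hs'
  obtain ⟨k, hk⟩ := exists_pow_isIdempotentElem (c' * p * b * z * c)
  set g := c' * p * b * z * c with hg
  have h1 : s' * g = s' := by
    calc s' * g = s' * c' * p * b * z * c := by simp only [hg, mul_assoc]
      _ = s' := by rw [← hc', h, ← hc]
  have h2 : ∀ k, s' * g ^ k = s' := by
    intro k
    induction k with
    | zero => simp
    | succ k ih => rw [pow_succ, ← mul_assoc, ih, h1]
  have h3 := hDA (g ^ (k + 1)) b (c' * p) (z * c * g ^ k) hk (by
    rw [pow_succ']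
    nth_rw 1 [hg]
    simp only [mul_assoc])
  refine ⟨⟨g ^ (k + 1) * c', ?_⟩, c * b, by rw [hc, mul_assoc]⟩
  calc s = s' * (g ^ (k + 1) * b * g ^ (k + 1)) * c' := by rw [h3, h2, ← hc']
    _ = s' * g ^ (k + 1) * b * (g ^ (k + 1) * c') := by simp only [mul_assoc]
    _ = s' * b * (g ^ (k + 1) * c') := by rw [h2]

/-- Induction on the size of the right ideal `s T`.  Let `a` be the first letter of `u` that takes
`s` out of its `R`-class.  By `greenR_mul_of_greenR_mul`, the letter `a` does not occur before, so
it is its first occurrence in `u`, and one compares the factors of `u` and `v` before and after their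
first `a`. -/
lemma mul_prod_eq_of_equivX {m n : ℕ} (β : T →* N)
    (hK : ∀ e y : T, e * e = e → β y = β e → e * y = e)
    (hDA : ∀ f b z₁ z₂ : T, f * f = f → f = z₁ * b * z₂ → f * b * f = f) (hn : m ≤ n)
    (hβ : ∀ u v : List T, EquivY m n u v → β u.prod = β v.prod) (k : ℕ) :
    ∀ (s : T) (u v : List T), (Set.range fun x => s * x).ncard ≤ k →
      EquivX (m + 1) (n + 1 + k) u v → s * u.prod = s * v.prod := by
  induction k with
  | zero =>
    intro s u v hk
    have := (Set.ncard_eq_zero (Set.toFinite _)).1 (Nat.le_zero.1 hk)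
    exact absurd (this ▸ Set.mem_range_self (1 : T)) (Set.notMem_empty _)
  | succ k ih =>
    intro s u v hk huv
    rw [← add_assoc] at huv
    -- words all of whose letters preserve the `R`-class of `s` preserve it
    have hgood : ∀ w : List T, (∀ b ∈ w, ¬ ¬ ∀ s', GreenR s s' → GreenR s (s' * b)) →
        ∀ s', GreenR s s' → GreenR s (s' * w.prod) := by
      intro w
      induction w with
      | nil => simp
      | cons b w ihw =>
        intro hw s' hs'
        rw [List.prod_cons, ← mul_assoc]
        exact ihw (fun c hc => hw c (List.mem_cons_of_mem _ hc)) _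
          (not_not.1 (hw b List.mem_cons_self) s' hs')
    have hrefl : GreenR s s := ⟨⟨1, by simp⟩, 1, by simp⟩
    by_cases hbad : ∃ b ∈ u, ¬ ∀ s', GreenR s s' → GreenR s (s' * b)
    · obtain ⟨u₁, b, u₂, rfl, hb, hu₁⟩ := exists_first hbad
      have hbu : b ∉ u₁ := fun h => hu₁ b h hb
      obtain ⟨v₁, v₂, rfl, hbv⟩ := List.eq_append_cons_of_mem
        ((huv.mem_iff (by omega) (by omega) b).1 (by simp))
      obtain ⟨⟨x, hx⟩, -⟩ := hgood u₁ hu₁ s hrefl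
      have h1 : s * u₁.prod = s * v₁.prod := mul_eq_mul_of_fiber β hK hx.symm
        (hβ _ _ ((huv.left hbu hbv).mono (by omega)))
      have h2 : s * u₁.prod * b * u₂.prod = s * u₁.prod * b * v₂.prod := by
        refine ih _ _ _ ?_ (huv.right hbu hbv)
        refine Nat.le_of_lt_succ (lt_of_lt_of_le (Set.ncard_lt_ncard ?_ (Set.toFinite _)) hk)
        refine ⟨?_, fun h => ?_⟩
        · rintro _ ⟨y, rfl⟩
          exact ⟨u₁.prod * b * y, by simp only [mul_assoc]⟩
        · obtain ⟨z, hz⟩ := h ⟨1, mul_one s⟩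
          exact hb fun s' => greenR_mul_of_greenR_mul hDA hz
      simp only [List.prod_append, List.prod_cons]
      calc s * (u₁.prod * (b * u₂.prod)) = s * u₁.prod * b * u₂.prod := by simp only [mul_assoc]
        _ = s * v₁.prod * b * v₂.prod := by rw [h2, h1]
        _ = s * (v₁.prod * (b * v₂.prod)) := by simp only [mul_assoc]
    · push Not at hbad
      obtain ⟨⟨x, hx⟩, -⟩ := hgood u (fun b hb => not_not.2 (hbad b hb)) s hrefl
      exact mul_eq_mul_of_fiber β hK hx.symm
        (hβ _ _ ((huv.lower (n := n + 1 + k) (by omega)).2.mono (by omega)))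

end Descent

/-- The Mal'cev product of `K` and `L_m` is contained in `R_{m+1}`. -/
theorem pvR_succ_of_malcev {m : ℕ} {M : Type} [Monoid M] (h : malcev pvK (pvL m) M) :
    pvR (m + 1) M := by
  obtain ⟨T, N, _, _, α, β, _, hα, -, hN, hK⟩ := malcev_pvK_iff.1 h
  obtain ⟨_, n, hn⟩ := (pvL_iff m N).1 hN
  have hDA : ∀ f b z₁ z₂ : T, f * f = f → f = z₁ * b * z₂ → f * b * f = f := by
    intro f b z₁ z₂ hf hfz
    have h1 := hN.idempotent_absorbs (f := β f) (b := β b) (z₁ := β z₁) (z₂ := β z₂)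
      (by rw [← map_mul, hf]) (by rw [hfz]; simp)
    have h2 := hK f (f * b * f) hf (by simpa using h1)
    rwa [mul_assoc f b f, ← mul_assoc f f, hf, ← mul_assoc] at h2
  have hβ : ∀ u v : List T, EquivY m (max m n) u v → β u.prod = β v.prod := by
    intro u v huv
    have := (isStableFamily_equivY m).map_eq hn (β.comp (FreeMonoid.lift id))
      (u := FreeMonoid.ofList u) (v := FreeMonoid.ofList v) (EquivY.mono huv (le_max_right _ _))
    simpa [FreeMonoid.lift_apply] using this
  have hT : Finite T ∧ ∃ n, ∀ u v : List T, EquivX (m + 1) n u v → u.prod = v.prod := by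
    refine ⟨inferInstance, max m n + 1 + (Set.range fun x : T => 1 * x).ncard, fun u v huv => ?_⟩
    simpa using mul_prod_eq_of_equivX β hK hDA (le_max_left _ _) hβ _ 1 u v le_rfl huv
  rw [pvR_iff]
  exact (isStableFamily_equivX (m + 1)).isPseudovariety_sat.image T M α hα hT

theorem pvR_succ_iff {m : ℕ} (hm : 1 ≤ m) (M : Type) [Monoid M] :
    pvR (m + 1) M ↔ malcev pvK (pvL m) M :=
  ⟨malcev_of_pvR_succ hm, pvR_succ_of_malcev⟩

/-! ### The pseudovariety of `R`-trivial monoids -/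

lemma equivY_one_iff {A : Type} {n : ℕ} {u v : List A} :
    EquivY 1 n u v ↔ ∀ l : List A, l.length ≤ n → (List.Sublist l u ↔ List.Sublist l v) := by
  rw [← equivX_reverse, equivX_one_iff]
  refine ⟨fun h l hl => ?_, fun h l hl => ?_⟩
  · simpa using h l.reverse (by simpa using hl)
  · simpa [← List.reverse_sublist (l₁ := l)] using h l.reverse (by simpa using hl)

theorem pvR_two_iff (M : Type) [Monoid M] : pvR 2 M ↔ pvRTrivial M := by
  constructor
  · intro h
    obtain ⟨hM, n, hn⟩ := (pvR_iff 2 M).1 h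
    refine ⟨hM, ?_⟩
    rintro s t ⟨⟨q, hq⟩, p, hp⟩
    set x := [p, q] with hx
    -- words over `{p, q}` that contain all the short words over `{p, q}` as subwords
    have hY : ∀ y z : List M, (∀ a ∈ y, a ∈ x) → (∀ a ∈ z, a ∈ x) →
        EquivY 1 (n + 1) (wordPow (n + 1) x ++ y) (wordPow (n + 1) x ++ z) := by
      intro y z hy hz
      have hw : ∀ w : List M, (∀ a ∈ w, a ∈ x) → ∀ a ∈ wordPow (n + 1) x ++ w, a ∈ x := by
        intro w hw a ha
        rcases List.mem_append.1 ha with ha | ha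
        exacts [mem_wordPow ha, hw a ha]
      rw [equivY_one_iff]
      refine fun l hl => ⟨fun h => ?_, fun h => ?_⟩
      · exact (sublist_wordPow (fun a ha => hw y hy a (h.subset ha)) hl).trans
          (List.sublist_append_left _ _)
      · exact (sublist_wordPow (fun a ha => hw z hz a (h.subset ha)) hl).trans
          (List.sublist_append_left _ _)
    have h1 := equivX_wordPow_append (m := 1) le_rfl (Nat.le_add_left 1 n)
      (by simpa using hY (wordPow (n + 1) x) [] (fun a => mem_wordPow) (by simp))
      (by simpa using hY [p] [] (by simp [hx]) (by simp))
    have h2 := congrArg (s * ·) (hn _ _ (h1.mono (Nat.le_succ n)))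
    simp only [List.prod_append, prod_wordPow] at h2
    have hpow : ∀ k, s * x.prod ^ k = s := by
      intro k
      induction k with
      | zero => simp
      | succ k ih => rw [pow_succ, ← mul_assoc, ih]; simp [hx, ← mul_assoc, ← hp, ← hq]
    rw [← pow_mul, ← mul_assoc, hpow, ← mul_assoc, hpow, List.prod_singleton, ← hp] at h2
    exact h2.symm
  · rintro ⟨_, hM⟩
    have hY := isStableFamily_equivY 1
    have : Finite (hY.con M 1).Quotient := hY.finite_quotient _ fun _ _ h => h
    refine pvR_succ_of_malcev (malcev_pvK_of_con (FreeMonoid.lift (id : M → M))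
      (fun x => ⟨FreeMonoid.of x, by simp⟩) (hY.con M 1)
      ((pvL_iff _ _).2 (hY.sat_quotient _ fun _ _ h => h)) fun e y he _ hye => ?_)
    simp only [FreeMonoid.lift_apply, List.map_id] at he ⊢
    have hmem : ∀ a ∈ y.toList, a ∈ e.toList := fun a =>
      (EquivY.mem_iff hye le_rfl le_rfl a).1
    -- an idempotent product absorbs each of its letters
    have habs : ∀ a ∈ e.toList, e.toList.prod * a = e.toList.prod := by
      intro a ha
      obtain ⟨e₁, e₂, h, -⟩ := List.eq_append_cons_of_mem ha
      set f := e.toList.prod with hf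
      have hfe : f = e₁.prod * a * e₂.prod := by rw [hf, h]; simp [mul_assoc]
      have h1 : f = f * e₁.prod := by
        refine hM _ _ ⟨⟨a * e₂.prod, ?_⟩, e₁.prod, rfl⟩
        rw [mul_assoc, ← mul_assoc e₁.prod, ← hfe, he]
      have h2 : f = f * (e₁.prod * a) := by
        refine hM _ _ ⟨⟨e₂.prod, ?_⟩, e₁.prod * a, rfl⟩
        rw [mul_assoc, ← hfe, he]
      rw [← mul_assoc, ← h1] at h2
      exact h2.symm
    generalize y.toList = w at hmem
    induction w with
    | nil => simp
    | cons a w ih =>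
      rw [List.prod_cons, ← mul_assoc, habs a (hmem a List.mem_cons_self)]
      exact ih fun b hb => hmem b (List.mem_cons_of_mem _ hb)


/-! ### Marked products -/

/-- Membership in `K a L`. -/
lemma mem_mul_letter_mul {K L : Language A} {a : A} {w : List A} :
    w ∈ K * (({[a]} : Language A) * L) ↔ ∃ x ∈ K, ∃ y ∈ L, w = x ++ a :: y := by
  simp only [Language.mem_mul]
  constructor
  · rintro ⟨x, hx, _, ⟨z, hz, y, hy, rfl⟩, rfl⟩
    obtain rfl : z = [a] := hz
    exact ⟨x, hx, y, hy, rfl⟩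
  · rintro ⟨x, hx, y, hy, rfl⟩
    exact ⟨x, hx, a :: y, ⟨[a], rfl, y, hy, rfl⟩, rfl⟩

lemma mem_markedProduct_zero {L : ℕ → Language A} {a : ℕ → A} {w : List A} :
    w ∈ markedProduct L a 0 ↔ w ∈ L 0 := by
  simp [markedProduct]

lemma markedProduct_succ (L : ℕ → Language A) (a : ℕ → A) (k : ℕ) :
    markedProduct L a (k + 1) =
      L 0 * (({[a 0]} : Language A) * markedProduct (fun i => L (i + 1))
        (fun i => a (i + 1)) k) := by
  simp only [markedProduct, List.range_succ_eq_map, List.map_cons, List.map_map, List.prod_cons,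
    mul_assoc, Function.comp_def, Nat.succ_eq_add_one, zero_add]

lemma mem_markedProduct_succ {L : ℕ → Language A} {a : ℕ → A} {k : ℕ} {w : List A} :
    w ∈ markedProduct L a (k + 1) ↔ ∃ x ∈ L 0,
      ∃ y ∈ markedProduct (fun i => L (i + 1)) (fun i => a (i + 1)) k, w = x ++ a 0 :: y := by
  rw [markedProduct_succ, mem_mul_letter_mul]

lemma mem_prefixProduct_zero {L : ℕ → Language A} {a : ℕ → A} {w : List A} :
    w ∈ prefixProduct L a 0 ↔ w = [] := by
  simp [prefixProduct, Language.mem_one]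

lemma mem_prefixProduct_succ {L : ℕ → Language A} {a : ℕ → A} {i : ℕ} {w : List A} :
    w ∈ prefixProduct L a (i + 1) ↔ ∃ x ∈ L 0,
      ∃ y ∈ prefixProduct (fun i => L (i + 1)) (fun i => a (i + 1)) i, w = x ++ a 0 :: y := by
  rw [← mem_mul_letter_mul]
  simp only [prefixProduct, List.range_succ_eq_map, List.map_cons, List.map_map, List.prod_cons,
    mul_assoc, Function.comp_def, Nat.succ_eq_add_one]

/-- A visibly deterministic product is deterministic. -/
lemma IsVDet.isDet {k : ℕ} {L : ℕ → Language A} {a : ℕ → A} (h : IsVDet L a k) : IsDet L a k := by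
  induction k generalizing L a with
  | zero =>
    intro i hi u _
    obtain rfl := Nat.le_zero.1 hi
    exact ⟨[], by simp [mem_prefixProduct_zero], fun p hp => mem_prefixProduct_zero.1 hp.2⟩
  | succ k ih =>
    rintro (_ | i) hi u hu
    · exact ⟨[], by simp [mem_prefixProduct_zero], fun p hp => mem_prefixProduct_zero.1 hp.2⟩
    · obtain ⟨x, hx, y, hy, rfl⟩ := mem_markedProduct_succ.1 hu
      have hvis : ∀ w ∈ L 0, a 0 ∉ w := h 0 (Nat.succ_pos k)
      obtain ⟨p, ⟨hp1, hp2⟩, huniq⟩ := ih (L := fun i => L (i + 1)) (a := fun i => a (i + 1))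
        (fun i hi => h (i + 1) (Nat.succ_lt_succ hi)) i (Nat.le_of_succ_le_succ hi) y hy
      refine ⟨x ++ a 0 :: p, ⟨?_, mem_prefixProduct_succ.2 ⟨x, hx, p, hp2, rfl⟩⟩, ?_⟩
      · rw [List.prefix_append_right_inj]
        exact List.cons_prefix_cons.2 ⟨rfl, hp1⟩
      · rintro q ⟨⟨t, ht⟩, hq2⟩
        obtain ⟨x', hx', p', hp', rfl⟩ := mem_prefixProduct_succ.1 hq2
        rw [List.append_assoc, List.cons_append] at ht
        obtain ⟨rfl, rfl⟩ := append_cons_inj_of_notMem ht (hvis x' hx') (hvis x hx)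
        rw [huniq p' ⟨List.prefix_append _ _, hp'⟩]

/-- Words of the tail are compared after prefixing a word of `L₀`, which has to be non-empty. -/
lemma IsDet.tail {k : ℕ} {L : ℕ → Language A} {a : ℕ → A} (h : IsDet L a (k + 1))
    {x : List A} (hx : x ∈ L 0) : IsDet (fun i => L (i + 1)) (fun i => a (i + 1)) k := by
  intro i hi u hu
  have hu' : x ++ a 0 :: u ∈ markedProduct L a (k + 1) :=
    mem_markedProduct_succ.2 ⟨x, hx, u, hu, rfl⟩
  obtain ⟨p, -, huniq⟩ := h (i + 1) (Nat.succ_le_succ hi) _ hu'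
  -- any word of a product has a prefix in each of its prefix products
  have hex : ∃ q, q <+: u ∧ q ∈ prefixProduct (fun i => L (i + 1)) (fun i => a (i + 1)) i := by
    clear hu' huniq hx p
    revert hi hu
    generalize (fun i => L (i + 1)) = L
    generalize (fun i => a (i + 1)) = a
    intro hi hu
    clear h
    induction i generalizing k u L a with
    | zero => exact ⟨[], by simp, mem_prefixProduct_zero.2 rfl⟩
    | succ i ih =>
      obtain ⟨k, rfl⟩ : ∃ j, k = j + 1 := ⟨k - 1, by omega⟩
      obtain ⟨x, hx, y, hy, rfl⟩ := mem_markedProduct_succ.1 hu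
      obtain ⟨q, hq1, hq2⟩ := ih y _ _ (Nat.le_of_succ_le_succ hi) hy
      exact ⟨x ++ a 0 :: q, (List.prefix_append_right_inj _).2 (List.cons_prefix_cons.2 ⟨rfl, hq1⟩),
        mem_prefixProduct_succ.2 ⟨x, hx, q, hq2, rfl⟩⟩
  obtain ⟨q, hq1, hq2⟩ := hex
  have hlift : ∀ q, q <+: u → q ∈ prefixProduct (fun i => L (i + 1)) (fun i => a (i + 1)) i →
      x ++ a 0 :: q = p := fun q hq1 hq2 =>
    huniq _ ⟨(List.prefix_append_right_inj _).2 (List.cons_prefix_cons.2 ⟨rfl, hq1⟩),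
      mem_prefixProduct_succ.2 ⟨x, hx, q, hq2, rfl⟩⟩
  refine ⟨q, ⟨hq1, hq2⟩, fun q' hq' => ?_⟩
  have := (hlift q' hq'.1 hq'.2).trans (hlift q hq1 hq2).symm
  simpa using this

/-! ### Regularity of marked products -/

lemma finite_range_of_factors {α β κ : Type} [Finite κ] (f : α → κ) (g : α → β)
    (h : ∀ u v, f u = f v → g u = g v) : (Set.range g).Finite := by
  classical
  by_cases hα : Nonempty α
  · have : Nonempty β := hα.map g
    refine (Set.finite_range (Function.extend f g fun _ => Classical.arbitrary β)).subset ?_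
    rintro _ ⟨u, rfl⟩
    exact ⟨f u, Function.FactorsThrough.extend_apply (fun u v => h u v) _ u⟩
  · rw [not_nonempty_iff] at hα
    simp [Set.range_eq_empty]

/-- The left quotient of `K a L` by `u` is the union of `(K / u) a L` and of the quotients `L / u'`
over all factorizations `u = x a u'` with `x` in `K`. -/
lemma finite_range_leftQuotient_mul {K L : Language A} (a : A)
    (hK : (Set.range K.leftQuotient).Finite) (hL : (Set.range L.leftQuotient).Finite) :
    (Set.range (K * (({[a]} : Language A) * L)).leftQuotient).Finite := by
  refine (hK.prod hL.finite_subsets |>.image fun P : Language A × Set (Language A) =>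
    ({z | z ∈ P.1 * (({[a]} : Language A) * L) ∨ ∃ q ∈ P.2, z ∈ q} : Language A)).subset ?_
  rintro _ ⟨u, rfl⟩
  refine ⟨(K.leftQuotient u, {q | ∃ x ∈ K, ∃ u', u = x ++ a :: u' ∧ q = L.leftQuotient u'}),
    ⟨⟨u, rfl⟩, ?_⟩, ?_⟩
  · rintro q ⟨x, -, u', -, rfl⟩
    exact ⟨u', rfl⟩
  · ext z
    change (z ∈ K.leftQuotient u * (({[a]} : Language A) * L) ∨ _) ↔
      u ++ z ∈ K * (({[a]} : Language A) * L)
    rw [mem_mul_letter_mul, mem_mul_letter_mul]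
    constructor
    · rintro (⟨x, hx, y, hy, rfl⟩ | ⟨_, ⟨x, hx, u', rfl, rfl⟩, hz⟩)
      · exact ⟨u ++ x, hx, y, hy, by simp⟩
      · exact ⟨x, hx, u' ++ z, hz, by simp⟩
    · rintro ⟨x, hx, y, hy, h⟩
      rcases append_eq_append_cons h with ⟨u', rfl, rfl⟩ | ⟨p, rfl, rfl⟩
      · exact .inr ⟨_, ⟨x, hx, u', rfl, rfl⟩, hy⟩
      · exact .inl ⟨p, hx, y, hy, rfl⟩

lemma finite_range_leftQuotient_markedProduct {k : ℕ} {L : ℕ → Language A} {a : ℕ → A}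
    (h : ∀ i ≤ k, (Set.range (L i).leftQuotient).Finite) :
    (Set.range (markedProduct L a k).leftQuotient).Finite := by
  induction k generalizing L a with
  | zero =>
    have : markedProduct L a 0 = L 0 := by
      ext w
      exact mem_markedProduct_zero
    rw [this]
    exact h 0 le_rfl
  | succ k ih =>
    rw [markedProduct_succ]
    exact finite_range_leftQuotient_mul _ (h 0 (Nat.zero_le _))
      (ih fun i hi => h (i + 1) (Nat.succ_le_succ hi))

/-- The syntactic congruence of a language. -/
def syntacticCon (L : Language A) : Con (FreeMonoid A) where
  r u v := ∀ s t : List A, s ++ (u.toList ++ t) ∈ L ↔ s ++ (v.toList ++ t) ∈ L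
  iseqv := ⟨fun _ _ _ => Iff.rfl, fun h s t => (h s t).symm, fun h h' s t => (h s t).trans (h' s t)⟩
  mul' {u v u' v'} h h' s t := by
    simp only [FreeMonoid.toList_mul, List.append_assoc]
    rw [h s (u'.toList ++ t), ← List.append_assoc, h' (s ++ v.toList) t, List.append_assoc]

lemma finite_syntacticCon {L : Language A} (h : (Set.range L.leftQuotient).Finite) :
    Finite (syntacticCon L).Quotient := by
  have := h.to_subtype
  refine Finite.of_injective (β := Set.range L.leftQuotient → Set.range L.leftQuotient)
    (fun q s => ⟨s.1.leftQuotient (Quotient.out q).toList, ?_⟩) fun q q' hq => ?_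
  · obtain ⟨u, hu⟩ := s.2
    exact ⟨u ++ (Quotient.out q).toList, by rw [Language.leftQuotient_append, hu]⟩
  · rw [← Quotient.out_eq q, ← Quotient.out_eq q']
    refine Quotient.sound (fun s t => ?_ : syntacticCon L (Quotient.out q) (Quotient.out q'))
    have := congrArg Subtype.val (congrFun hq ⟨L.leftQuotient s, s, rfl⟩)
    exact Set.ext_iff.1 this t

/-! ### Deterministic products of languages of `𝓛_m` -/

lemma equivY_wordPow {m n : ℕ} {x : List A} (hx : EquivY m n (x ++ x) x) (p : ℕ) :
    EquivY m n (wordPow (p + 1) x) x := by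
  induction p with
  | zero => simpa [wordPow] using EquivY.refl m n x
  | succ p ih =>
    rw [wordPow_succ]
    exact ((EquivY.refl _ _ x).append_append ih).trans hx

/-- In a deterministic product, the factor `g` of `s x g t` does not contain the first marked letter
if `x g` is equivalent to `x`: otherwise a pumped word of the product would have two prefixes in
`L₀ a₁`. -/
lemma IsDet.first_letter {m n k : ℕ} {L : ℕ → Language A} {a : ℕ → A}
    (hdet : IsDet L a (k + 1)) (hL : ∀ u v, EquivY m n u v → (u ∈ L 0 ↔ v ∈ L 0))
    {s x g t : List A} (hg : EquivY m n (x ++ g) x)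
    (h : s ++ (x ++ (g ++ t)) ∈ markedProduct L a (k + 1)) :
    (∃ s₀ s', s = s₀ ++ a 0 :: s' ∧ s₀ ∈ L 0 ∧ s' ++ (x ++ (g ++ t)) ∈
      markedProduct (fun i => L (i + 1)) (fun i => a (i + 1)) k) ∨
    (∃ x₁ x₂, x = x₁ ++ a 0 :: x₂ ∧ s ++ x₁ ∈ L 0 ∧ x₂ ++ (g ++ t) ∈
      markedProduct (fun i => L (i + 1)) (fun i => a (i + 1)) k) ∨
    (∃ t₀ t', t = t₀ ++ a 0 :: t' ∧ s ++ (x ++ (g ++ t₀)) ∈ L 0 ∧ t' ∈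
      markedProduct (fun i => L (i + 1)) (fun i => a (i + 1)) k) := by
  obtain ⟨w, hw, y, hy, e⟩ := mem_markedProduct_succ.1 h
  rcases append_eq_append_cons e with ⟨s', rfl, rfl⟩ | ⟨w₁, rfl, e₁⟩
  · exact .inl ⟨w, s', rfl, hw, hy⟩
  rcases append_eq_append_cons e₁ with ⟨x', rfl, rfl⟩ | ⟨w₂, rfl, e₂⟩
  · exact .inr (.inl ⟨w₁, x', rfl, hw, hy⟩)
  rcases append_eq_append_cons e₂ with ⟨g', rfl, rfl⟩ | ⟨w', rfl, rfl⟩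
  · exfalso
    set g := w₂ ++ a 0 :: g' with hgdef
    have hw2 : s ++ (x ++ (g ++ w₂)) ∈ L 0 := by
      refine (hL _ _ ?_).2 hw
      rw [← List.append_assoc x]
      exact hg.append s w₂
    have hmem : s ++ (x ++ (g ++ (g ++ t))) ∈ markedProduct L a (k + 1) :=
      mem_markedProduct_succ.2 ⟨_, hw2, _, hy, by simp [hgdef]⟩
    have huniq := (hdet 1 (by omega) _ hmem).unique
      (y₁ := s ++ (x ++ (w₂ ++ [a 0]))) (y₂ := s ++ (x ++ (g ++ (w₂ ++ [a 0]))))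
      ⟨⟨g' ++ (g ++ t), by simp [hgdef]⟩, mem_prefixProduct_succ.2
        ⟨_, hw, [], mem_prefixProduct_zero.2 rfl, by simp⟩⟩
      ⟨⟨g' ++ t, by simp [hgdef]⟩, mem_prefixProduct_succ.2
        ⟨_, hw2, [], mem_prefixProduct_zero.2 rfl, by simp⟩⟩
    have := congrArg List.length huniq
    simp only [List.length_append, hgdef, List.length_cons] at this
    omega
  · exact .inr (.inr ⟨w', y, rfl, hw, hy⟩)

/-- A deterministic product with `k` marked letters cannot distinguish words that follow a power
`x^{k+1}` of an idempotent and are absorbed by it. -/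
lemma IsDet.absorb {m n : ℕ} {x y z : List A} (hx : EquivY m n (x ++ x) x)
    (hy : EquivY m n (x ++ y) x) (hz : EquivY m n (x ++ z) x) {k : ℕ} :
    ∀ {L : ℕ → Language A} {a : ℕ → A}, IsDet L a k →
      (∀ i ≤ k, ∀ u v, EquivY m n u v → (u ∈ L i ↔ v ∈ L i)) →
      ∀ (p : ℕ) (s t : List A), k ≤ p →
        s ++ (wordPow (p + 1) x ++ (y ++ t)) ∈ markedProduct L a k →
        s ++ (wordPow (p + 1) x ++ (z ++ t)) ∈ markedProduct L a k := by
  have habs : ∀ (w : List A), EquivY m n (x ++ w) x → ∀ p,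
      EquivY m n (wordPow (p + 1) x ++ w) x := by
    intro w hw p
    rw [wordPow_succ', List.append_assoc]
    refine ((EquivY.refl _ _ (wordPow p x)).append_append hw).trans ?_
    rw [← wordPow_succ']
    exact equivY_wordPow hx p
  have hyz : ∀ (p : ℕ) (s t : List A), EquivY m n (s ++ (wordPow (p + 1) x ++ (y ++ t)))
      (s ++ (wordPow (p + 1) x ++ (z ++ t))) := by
    intro p s t
    rw [← List.append_assoc _ y, ← List.append_assoc _ z]
    exact ((habs y hy p).trans (habs z hz p).symm).append s t
  induction k with
  | zero =>
    intro L a _ hL p s t _ h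
    rw [mem_markedProduct_zero] at h ⊢
    exact (hL 0 le_rfl _ _ (hyz p s t)).1 h
  | succ k ih =>
    intro L a hdet hL p s t hp h
    obtain ⟨p, rfl⟩ : ∃ q, p = q + 1 := ⟨p - 1, by omega⟩
    have hg : EquivY m n (x ++ (wordPow (p + 1) x ++ y)) x := by
      rw [← List.append_assoc, ← wordPow_succ]
      exact habs y hy (p + 1)
    have hL' : ∀ i ≤ k, ∀ u v, EquivY m n u v → (u ∈ L (i + 1) ↔ v ∈ L (i + 1)) :=
      fun i hi => hL (i + 1) (Nat.succ_le_succ hi)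
    have e : ∀ w : List A, wordPow (p + 1 + 1) x ++ (w ++ t) =
        x ++ ((wordPow (p + 1) x ++ w) ++ t) := fun w => by
      rw [wordPow_succ (p + 1)]
      simp only [List.append_assoc]
    have h' := h
    rw [e] at h'
    rw [mem_markedProduct_succ]
    rcases hdet.first_letter (hL 0 (Nat.zero_le _)) hg h' with
      ⟨s₀, s', rfl, h1, h2⟩ | ⟨x₁, x₂, hxx, h1, h2⟩ | ⟨t₀, t', rfl, h1, h2⟩
    · rw [← e] at h2
      exact ⟨s₀, h1, _, ih (hdet.tail h1) hL' (p + 1) s' t (by omega) h2, by simp⟩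
    · rw [List.append_assoc (wordPow _ _)] at h2
      refine ⟨s ++ x₁, h1, _, ih (hdet.tail h1) hL' p x₂ t (by omega) h2, ?_⟩
      rw [wordPow_succ (p + 1)]
      nth_rw 1 [hxx]
      simp
    · have h3 : s ++ (wordPow (p + 1 + 1) x ++ (y ++ t₀)) ∈ L 0 := by
        rw [wordPow_succ (p + 1)]
        simpa using h1
      exact ⟨_, (hL 0 (Nat.zero_le _) _ _ (hyz (p + 1) s t₀)).1 h3, t', h2, by simp⟩

/-- Deterministic products of languages of `𝓛_m` are in `𝓡_{m+1}`, as the syntactic monoid of the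
product is in the Mal'cev product of `K` and `L_m`. -/
lemma IsDet.mem_langR [Finite A] {m k : ℕ} {L : ℕ → Language A} {a : ℕ → A}
    (hdet : IsDet L a k) (hL : ∀ i ≤ k, L i ∈ langL m A) :
    markedProduct L a k ∈ langR (m + 1) A := by
  have h1 : ∀ i : Fin (k + 1), ∃ n, ∀ u v : List A, EquivY m n u v → (u ∈ L i ↔ v ∈ L i) :=
    fun i => (mem_langL_iff m A _).1 (hL i (Nat.lt_succ_iff.1 i.2))
  choose f hf using h1
  obtain ⟨n, hn⟩ := Finite.exists_le f
  have hsat : ∀ i ≤ k, ∀ u v, EquivY m n u v → (u ∈ L i ↔ v ∈ L i) := fun i hi u v huv =>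
    hf ⟨i, Nat.lt_succ_iff.2 hi⟩ u v (huv.mono (hn _))
  have hE := isStableFamily_equivY m
  have hreg : (Set.range (markedProduct L a k).leftQuotient).Finite := by
    refine finite_range_leftQuotient_markedProduct fun i hi => ?_
    obtain ⟨κ, _, g, hg⟩ := hE.finite A n
    refine finite_range_of_factors g _ fun u v huv => ?_
    ext z
    exact hsat i hi _ _ ((hg u v huv).append_append (EquivY.refl m n z))
  have := finite_syntacticCon hreg
  have : Finite (hE.con A n).Quotient := hE.finite_quotient _ fun _ _ h => h
  have hM : pvR (m + 1) (syntacticCon (markedProduct L a k)).Quotient := by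
    refine pvR_succ_of_malcev (malcev_pvK_of_con (Con.mk' _) Con.mk'_surjective (hE.con A n)
      ((pvL_iff _ _).2 (hE.sat_quotient _ fun _ _ h => h)) fun e y he hee hye => ?_)
    rw [← map_wordPow_of_idempotent _ he k, ← map_mul]
    refine (Con.eq _).2 fun s t => ?_
    have hee' : EquivY m n (e.toList ++ e.toList) e.toList := hee
    have hy : EquivY m n (e.toList ++ y.toList) e.toList :=
      ((EquivY.refl _ _ _).append_append hye).trans hee'
    have hz : EquivY m n (e.toList ++ []) e.toList := by simpa using EquivY.refl m n e.toList
    rw [FreeMonoid.toList_mul, FreeMonoid.toList_ofList, List.append_assoc]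
    exact ⟨hdet.absorb hee' hy hz hsat k s t le_rfl, hdet.absorb hee' hz hy hsat k s t le_rfl⟩
  refine ⟨_, inferInstance, hM, Con.mk' _, fun w => ⟨fun h => ⟨w, h, rfl⟩, ?_⟩⟩
  rintro ⟨w', hw', h⟩
  have := (Con.eq _).1 h
  simpa using (this [] []).2 (by simpa using hw')

/-! ### Boolean combinations -/

/-- The languages of `𝓡_m` over `A`, as a Boolean algebra. -/
def langRSubalgebra (m : ℕ) (A : Type) [Finite A] : BooleanSubalgebra (Language A) where
  carrier := langR m A
  supClosed' K hK L hL := by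
    rw [mem_langR_iff] at hK hL ⊢
    obtain ⟨n, hn⟩ := hK
    obtain ⟨n', hn'⟩ := hL
    exact ⟨max n n', fun u v h => or_congr (hn u v (h.mono (le_max_left _ _)))
      (hn' u v (h.mono (le_max_right _ _)))⟩
  infClosed' K hK L hL := by
    rw [mem_langR_iff] at hK hL ⊢
    obtain ⟨n, hn⟩ := hK
    obtain ⟨n', hn'⟩ := hL
    exact ⟨max n n', fun u v h => and_congr (hn u v (h.mono (le_max_left _ _)))
      (hn' u v (h.mono (le_max_right _ _)))⟩
  compl_mem' {K} hK := by
    rw [mem_langR_iff] at hK ⊢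
    obtain ⟨n, hn⟩ := hK
    exact ⟨n, fun u v h => not_congr (hn u v h)⟩
  bot_mem' := (mem_langR_iff m A _).2 ⟨0, fun _ _ _ => Iff.rfl⟩

/-- A language that is saturated by membership in finitely many languages of a Boolean algebra
belongs to this Boolean algebra. -/
lemma mem_of_saturated {B : BooleanSubalgebra (Language A)} {F : Set (Language A)} (hF : F.Finite) :
    (∀ K ∈ F, K ∈ B) → ∀ L : Language A,
      (∀ u v : List A, (∀ K ∈ F, u ∈ K ↔ v ∈ K) → (u ∈ L ↔ v ∈ L)) → L ∈ B := by
  induction F, hF using Set.Finite.induction_on with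
  | empty =>
    intro _ L hL
    by_cases h : ∃ u, u ∈ L
    · obtain ⟨u, hu⟩ := h
      have : L = ⊤ := by
        ext v
        exact ⟨fun _ => trivial, fun _ => (hL u v (by simp)).1 hu⟩
      exact this ▸ BooleanSubalgebra.top_mem
    · have : L = ⊥ := by
        ext v
        exact ⟨fun hv => h ⟨v, hv⟩, fun hv => hv.elim⟩
      exact this ▸ BooleanSubalgebra.bot_mem
  | @insert K F _ _ ih =>
    intro hB L hL
    have hK := hB K (Set.mem_insert _ _)
    have hF := fun K hK => hB K (Set.mem_insert_of_mem _ hK)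
    -- saturation of `L ∩ P` with respect to the remaining languages
    let S : (List A → Prop) → Language A := fun P =>
      {w | ∃ u, u ∈ L ∧ P u ∧ ∀ K' ∈ F, u ∈ K' ↔ w ∈ K'}
    have hS : ∀ P, S P ∈ B := fun P => ih hF (S P) fun u v huv =>
      exists_congr fun w => and_congr_right fun _ => and_congr_right fun _ =>
        forall₂_congr fun K' hK' => iff_congr Iff.rfl (huv K' hK')
    have hLS : L = (S (· ∈ K) ⊓ K) ⊔ (S (· ∉ K) ⊓ Kᶜ) := by
      ext w
      constructor
      · intro hw
        by_cases hwK : w ∈ K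
        · exact .inl ⟨⟨w, hw, hwK, fun _ _ => Iff.rfl⟩, hwK⟩
        · exact .inr ⟨⟨w, hw, hwK, fun _ _ => Iff.rfl⟩, hwK⟩
      · rintro (⟨⟨u, hu, huK, h⟩, hwK⟩ | ⟨⟨u, hu, huK, h⟩, hwK⟩)
        · exact (hL u w (Set.forall_mem_insert.2 ⟨iff_of_true huK hwK, h⟩)).1 hu
        · exact (hL u w (Set.forall_mem_insert.2 ⟨iff_of_false huK hwK, h⟩)).1 hu
    rw [hLS]
    exact BooleanSubalgebra.sup_mem (BooleanSubalgebra.inf_mem (hS _) hK)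
      (BooleanSubalgebra.inf_mem (hS _) (BooleanSubalgebra.compl_mem hK))

/-- The words on which a given ranker is condensed. -/
def condLanguage (r : List (RankerLetter A)) : Language A := {u | Cond r u}

lemma condLanguage_mem_langL [Finite A] {m : ℕ} {b : A} {r : List (RankerLetter A)}
    (h : numBlocks (.Y b :: r) ≤ m) : condLanguage (.Y b :: r) ∈ langL m A := by
  rw [mem_langL_iff]
  refine ⟨r.length + 2, fun u v huv => ?_⟩
  rw [equivY_iff] at huv
  obtain h | h := h.eq_or_lt
  · exact huv.1 b r h (by omega)
  · exact huv.2 _ h (by simp)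

/-- The words on which a ranker that starts with an `X`-letter is condensed form a visibly
deterministic product: each letter of the first block cuts at a first occurrence. -/
lemma condLanguage_eq_markedProduct [Finite A] {m : ℕ} (hm : 1 ≤ m) (r : List (RankerLetter A)) :
    ∀ a₀ : A, numBlocks (.X a₀ :: r) ≤ m + 1 → ∃ (k : ℕ) (L : ℕ → Language A) (a : ℕ → A), 1 ≤ k ∧
      (∀ i ≤ k, L i ∈ langL m A) ∧ IsVDet L a k ∧
      condLanguage (.X a₀ :: r) = markedProduct L a k := by
  have hmem : ∀ a : A, ∃ n, ∀ u v : List A, EquivY m n u v → (a ∉ u ↔ a ∉ v) :=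
    fun a => ⟨m, fun u v huv => not_congr (huv.mem_iff hm le_rfl a)⟩
  have htop : (⊤ : Language A) ∈ langL m A := (mem_langL_iff _ _ _).2 ⟨0, fun _ _ _ => Iff.rfl⟩
  -- a product with a single marked letter and the second factor `A^*`
  have hone : ∀ (K : Language A) (a₀ : A), K ∈ langL m A → (∀ w ∈ K, a₀ ∉ w) →
      ∃ (k : ℕ) (L : ℕ → Language A) (a : ℕ → A), 1 ≤ k ∧ (∀ i ≤ k, L i ∈ langL m A) ∧
        IsVDet L a k ∧
        ({w | ∃ x ∈ K, ∃ y, w = x ++ a₀ :: y} : Language A) = markedProduct L a k := by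
    intro K a₀ hK hvis
    refine ⟨1, fun i => if i = 0 then K else ⊤, fun _ => a₀, le_rfl, fun i _ => ?_, ?_, ?_⟩
    · dsimp only
      split_ifs
      exacts [hK, htop]
    · intro i hi w hw
      obtain rfl : i = 0 := by omega
      exact hvis w hw
    · ext w
      refine Iff.trans ?_ mem_markedProduct_succ.symm
      refine exists_congr fun x => and_congr_right fun _ => exists_congr fun y => ?_
      rw [mem_markedProduct_zero]
      exact (and_iff_right (show y ∈ (⊤ : Language A) from trivial)).symm
  induction r with
  | nil =>
    intro a₀ _
    obtain ⟨k, L, a, h1, h2, h3, h4⟩ := hone {w | a₀ ∉ w} a₀ ((mem_langL_iff _ _ _).2 (hmem a₀))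
      fun w hw => hw
    refine ⟨k, L, a, h1, h2, h3, h4 ▸ ?_⟩
    ext w
    change (∃ p s, w = p ++ a₀ :: s ∧ a₀ ∉ p ∧ True) ↔ ∃ x, a₀ ∉ x ∧ ∃ y, w = x ++ a₀ :: y
    constructor
    · rintro ⟨p, s, h, h', -⟩
      exact ⟨p, h', s, h⟩
    · rintro ⟨p, h', s, h⟩
      exact ⟨p, s, h, h', trivial⟩
  | cons Z r ih =>
    intro a₀ hb
    cases Z with
    | Y b =>
      rw [numBlocks_X_Y] at hb
      obtain ⟨n, hn⟩ := (mem_langL_iff m A _).1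
        (condLanguage_mem_langL (Nat.le_of_succ_le_succ hb))
      obtain ⟨n', hn'⟩ := hmem a₀
      obtain ⟨k, L, a, h1, h2, h3, h4⟩ := hone {w | a₀ ∉ w ∧ Cond (.Y b :: r) w} a₀
        ((mem_langL_iff _ _ _).2 ⟨max n n', fun u v huv => and_congr
          (hn' u v (huv.mono (le_max_right _ _))) (hn u v (huv.mono (le_max_left _ _)))⟩)
        fun w hw => hw.1
      refine ⟨k, L, a, h1, h2, h3, h4 ▸ ?_⟩
      ext w
      change (∃ p s, w = p ++ a₀ :: s ∧ a₀ ∉ p ∧ Cond (.Y b :: r) p) ↔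
        ∃ x, (a₀ ∉ x ∧ Cond (.Y b :: r) x) ∧ ∃ y, w = x ++ a₀ :: y
      constructor
      · rintro ⟨p, s, h, h', h''⟩
        exact ⟨p, ⟨h', h''⟩, s, h⟩
      · rintro ⟨p, ⟨h', h''⟩, s, h⟩
        exact ⟨p, s, h, h', h''⟩
    | X b =>
      obtain ⟨k, L, a, h1, h2, h3, h4⟩ := ih b (by simpa using hb)
      refine ⟨k + 1, fun i => Nat.casesOn i {w | a₀ ∉ w} L, fun i => Nat.casesOn i a₀ a, by omega,
        ?_, ?_, ?_⟩
      · rintro (_ | i) hi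
        · exact (mem_langL_iff _ _ _).2 (hmem a₀)
        · exact h2 i (Nat.le_of_succ_le_succ hi)
      · rintro (_ | i) hi w hw
        · exact hw
        · exact h3 i (Nat.lt_of_succ_lt_succ hi) w hw
      · ext w
        rw [mem_markedProduct_succ]
        change _ ↔ ∃ x, a₀ ∉ x ∧ ∃ y ∈ markedProduct L a k, w = x ++ a₀ :: y
        rw [← h4]
        change (∃ p s, w = p ++ a₀ :: s ∧ a₀ ∉ p ∧ Cond (.X b :: r) s) ↔
          ∃ x, a₀ ∉ x ∧ ∃ y, Cond (.X b :: r) y ∧ w = x ++ a₀ :: y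
        constructor
        · rintro ⟨p, s, h, h', h''⟩
          exact ⟨p, h', s, h'', h⟩
        · rintro ⟨p, h', s, h'', h⟩
          exact ⟨p, s, h, h', h''⟩

theorem langR_succ_subset_vdetClosure [Finite A] {m : ℕ} (hm : 1 ≤ m) :
    langR (m + 1) A ⊆ vdetClosure (langL m) A := by
  intro L hL
  obtain ⟨n, hn⟩ := (mem_langR_iff _ _ _).1 hL
  have hfin : {r : List (RankerLetter A) | r.length ≤ n ∧
      ((∃ a r', r = .X a :: r' ∧ numBlocks r ≤ m + 1) ∨
        ∃ a r', r = .Y a :: r' ∧ numBlocks r ≤ m)}.Finite :=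
    (List.finite_length_le _ n).subset fun r hr => hr.1
  refine mem_of_saturated (hfin.image condLanguage) ?_ L fun u v huv => hn u v ?_
  · rintro _ ⟨_, ⟨-, ⟨a, r, rfl, hr⟩ | ⟨a, r, rfl, hr⟩⟩, rfl⟩
    · exact BooleanSubalgebra.subset_closure (.inr (condLanguage_eq_markedProduct hm r a hr))
    · exact BooleanSubalgebra.subset_closure (.inl (condLanguage_mem_langL hr))
  · rw [equivX_iff]
    refine ⟨fun a r hb hl => huv _ ⟨.X a :: r, ⟨hl, .inl ⟨a, r, rfl, hb.le⟩⟩, rfl⟩,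
      fun r hb hl => ?_⟩
    rcases r with _ | ⟨a | a, r⟩
    · simp [Cond]
    · exact huv _ ⟨_, ⟨hl.le, .inl ⟨a, r, rfl, hb.le⟩⟩, rfl⟩
    · exact huv _ ⟨_, ⟨hl.le, .inr ⟨a, r, rfl, Nat.lt_succ_iff.1 hb⟩⟩, rfl⟩

lemma vdetClosure_subset_detClosure (V : LanguageClass) : vdetClosure V A ⊆ detClosure V A := by
  refine BooleanSubalgebra.closure_mono (Set.union_subset_union_right _ ?_)
  rintro K ⟨k, L, a, h1, h2, h3, h4⟩
  exact ⟨k, L, a, h1, h2, h3.isDet, h4⟩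

theorem detClosure_subset_langR_succ [Finite A] (m : ℕ) :
    detClosure (langL m) A ⊆ langR (m + 1) A := by
  refine (BooleanSubalgebra.closure_le (L := langRSubalgebra (m + 1) A)).2 ?_
  rintro K (hK | ⟨k, L, a, -, h2, h3, rfl⟩)
  · obtain ⟨n, hn⟩ := (mem_langL_iff _ _ _).1 hK
    exact (mem_langR_iff _ _ _).2
      ⟨n + 1, fun u v huv => hn u v (huv.lower (Nat.lt_succ_self m)).2⟩
  · exact h3.mem_langR h2


/-! ### Duality for monoids -/

open MulOpposite in
lemma pvR_op_iff {m : ℕ} {M : Type} [Monoid M] : pvR m Mᵐᵒᵖ ↔ pvL m M := by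
  rw [pvR_iff, pvL_iff]
  refine and_congr ⟨fun _ => Finite.of_equiv _ opEquiv.symm, fun _ => Finite.of_equiv _ opEquiv⟩
    (exists_congr fun n => ⟨fun h u v huv => ?_, fun h u v huv => ?_⟩)
  · have := h (u.map op).reverse (v.map op).reverse (by
      rw [equivX_reverse, List.map_eq_flatMap, List.map_eq_flatMap]
      exact huv.flatMap _)
    rwa [← op_list_prod, ← op_list_prod, op_inj] at this
  · apply unop_injective
    rw [unop_list_prod, unop_list_prod]
    refine h _ _ ?_
    rw [equivY_reverse, List.map_eq_flatMap, List.map_eq_flatMap]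
    exact huv.flatMap _

open MulOpposite in
lemma pvL_op_iff {m : ℕ} {M : Type} [Monoid M] : pvL m Mᵐᵒᵖ ↔ pvR m M := by
  rw [pvR_iff, pvL_iff]
  refine and_congr ⟨fun _ => Finite.of_equiv _ opEquiv.symm, fun _ => Finite.of_equiv _ opEquiv⟩
    (exists_congr fun n => ⟨fun h u v huv => ?_, fun h u v huv => ?_⟩)
  · have := h (u.map op).reverse (v.map op).reverse (by
      rw [equivY_reverse, List.map_eq_flatMap, List.map_eq_flatMap]
      exact huv.flatMap _)
    rwa [← op_list_prod, ← op_list_prod, op_inj] at this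
  · apply unop_injective
    rw [unop_list_prod, unop_list_prod]
    refine h _ _ ?_
    rw [equivX_reverse, List.map_eq_flatMap, List.map_eq_flatMap]
    exact huv.flatMap _

lemma pvD_iff {S : Type} [Semigroup S] :
    pvD S ↔ Finite S ∧ ∀ e y : S, IsIdempotentElem e → y * e = e :=
  and_congr_right fun _ => ⟨fun h e y he => h e y e ⟨Subsemigroup.mem_closure_of_mem rfl, he⟩,
    fun h _ y e he => h e y he.2⟩

lemma malcev_pvD_iff {W : MonoidClass} {M : Type} [Monoid M] :
    malcev pvD W M ↔ ∃ (T N : Type) (_ : Monoid T) (_ : Monoid N) (α : T →* M) (β : T →* N),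
      Finite T ∧ Function.Surjective α ∧ Function.Surjective β ∧ W N ∧
      ∀ e y : T, e * e = e → β y = β e → y * e = e := by
  refine exists_congr fun T => exists_congr fun N => exists_congr fun _ => exists_congr fun _ =>
    exists_congr fun α => exists_congr fun β => and_congr_right fun hT => and_congr_right fun _ =>
    and_congr_right fun _ => and_congr_right fun _ => ?_
  constructor
  · intro h e y he hy
    have hβ : IsIdempotentElem (β e) := by rw [IsIdempotentElem, ← map_mul, he]
    exact congrArg Subtype.val ((pvD_iff.1 (h _ hβ)).2 ⟨e, rfl⟩ ⟨y, hy⟩ (Subtype.ext he))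
  · intro h f hf
    refine pvD_iff.2 ⟨Subtype.finite, fun e y he => Subtype.ext ?_⟩
    exact h e.1 y.1 (congrArg Subtype.val he) (y.2.trans e.2.symm)

lemma surjective_monoidHom_op {M N : Type} [Monoid M] [Monoid N] {f : M →* N}
    (hf : Function.Surjective f) : Function.Surjective (MonoidHom.op f) := fun x =>
  (hf x.unop).imp' MulOpposite.op fun _ h => MulOpposite.unop_injective h

lemma malcev_pvD_op {W W' : MonoidClass}
    (hW : ∀ (N : Type) [Monoid N], W N → W' Nᵐᵒᵖ) {M : Type} [Monoid M]
    (h : malcev pvK W M) : malcev pvD W' Mᵐᵒᵖ := by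
  obtain ⟨T, N, _, _, α, β, _, hα, hβ, hN, hK⟩ := malcev_pvK_iff.1 h
  refine malcev_pvD_iff.2 ⟨Tᵐᵒᵖ, Nᵐᵒᵖ, inferInstance, inferInstance, MonoidHom.op α,
    MonoidHom.op β, Finite.of_equiv _ MulOpposite.opEquiv, surjective_monoidHom_op hα,
    surjective_monoidHom_op hβ, hW N hN, fun e y he hy => MulOpposite.unop_injective ?_⟩
  exact hK e.unop y.unop (congrArg MulOpposite.unop he) (congrArg MulOpposite.unop hy)

lemma malcev_pvK_op {W W' : MonoidClass}
    (hW : ∀ (N : Type) [Monoid N], W N → W' Nᵐᵒᵖ) {M : Type} [Monoid M]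
    (h : malcev pvD W M) : malcev pvK W' Mᵐᵒᵖ := by
  obtain ⟨T, N, _, _, α, β, _, hα, hβ, hN, hD⟩ := malcev_pvD_iff.1 h
  refine malcev_pvK_iff.2 ⟨Tᵐᵒᵖ, Nᵐᵒᵖ, inferInstance, inferInstance, MonoidHom.op α,
    MonoidHom.op β, Finite.of_equiv _ MulOpposite.opEquiv, surjective_monoidHom_op hα,
    surjective_monoidHom_op hβ, hW N hN, fun e y he hy => MulOpposite.unop_injective ?_⟩
  exact hD e.unop y.unop (congrArg MulOpposite.unop he) (congrArg MulOpposite.unop hy)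

theorem pvL_succ_iff {m : ℕ} (hm : 1 ≤ m) (M : Type) [Monoid M] :
    pvL (m + 1) M ↔ malcev pvD (pvR m) M := by
  rw [← pvR_op_iff, pvR_succ_iff hm]
  refine ⟨fun h => ?_, malcev_pvK_op fun _ _ => pvL_op_iff.2⟩
  exact malcev_image (MulEquiv.opOp M).symm.toMonoidHom (MulEquiv.opOp M).symm.surjective
    (malcev_pvD_op (fun _ _ => pvR_op_iff.2) h)

theorem pvL_two_iff (M : Type) [Monoid M] : pvL 2 M ↔ pvLTrivial M := by
  rw [← pvR_op_iff, pvR_two_iff]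
  refine and_congr ⟨fun _ => Finite.of_equiv _ MulOpposite.opEquiv.symm,
    fun _ => Finite.of_equiv _ MulOpposite.opEquiv⟩ ⟨fun h s t => ?_, fun h s t => ?_⟩
  · rintro ⟨⟨x, hx⟩, y, hy⟩
    exact MulOpposite.op_injective (h (.op s) (.op t)
      ⟨⟨.op x, congrArg MulOpposite.op hx⟩, .op y, congrArg MulOpposite.op hy⟩)
  · rintro ⟨⟨x, hx⟩, y, hy⟩
    exact MulOpposite.unop_injective (h s.unop t.unop
      ⟨⟨x.unop, congrArg MulOpposite.unop hx⟩, y.unop, congrArg MulOpposite.unop hy⟩)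

/-! ### Duality for languages -/

lemma reverse_mem_langR_iff [Finite A] {m : ℕ} {L : Language A} :
    L.reverse ∈ langR m A ↔ L ∈ langL m A := by
  rw [mem_langR_iff, mem_langL_iff]
  refine exists_congr fun n => ⟨fun h u v huv => ?_, fun h u v huv => ?_⟩
  · simpa using h u.reverse v.reverse (equivX_reverse.2 huv)
  · exact h u.reverse v.reverse (equivY_reverse.2 huv)

lemma reverse_mem_langL_iff [Finite A] {m : ℕ} {L : Language A} :
    L.reverse ∈ langL m A ↔ L ∈ langR m A := by
  rw [← reverse_mem_langR_iff, Language.reverse_reverse]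

lemma reverse_mem_closure {S S' : Set (Language A)} (h : ∀ K ∈ S, K.reverse ∈ S') {L : Language A}
    (hL : L ∈ BooleanSubalgebra.closure S) : L.reverse ∈ BooleanSubalgebra.closure S' := by
  induction hL using BooleanSubalgebra.closure_bot_sup_induction with
  | mem K hK => exact BooleanSubalgebra.subset_closure (h K hK)
  | bot => exact BooleanSubalgebra.bot_mem
  | sup K _ L _ hK hL => exact BooleanSubalgebra.sup_mem hK hL
  | compl K _ hK => exact BooleanSubalgebra.compl_mem hK

/-- The factors of the mirror image of a product with `k` marked letters. -/
def revFactors (k : ℕ) (L : ℕ → Language A) : ℕ → Language A := fun i => (L (k - i)).reverse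

/-- The marked letters of the mirror image of a product with `k` marked letters. -/
def revLetters (k : ℕ) (a : ℕ → A) : ℕ → A := fun i => a (k - 1 - i)

lemma reverse_singleton (w : List A) :
    ({w} : Language A).reverse = ({w.reverse} : Language A) := by
  ext v
  exact List.reverse_eq_iff

lemma prefixProduct_rev (L : ℕ → Language A) (a : ℕ → A) {k i : ℕ} (hi : i ≤ k) :
    prefixProduct (revFactors k L) (revLetters k a) i = (suffixProduct L a k (k - i)).reverse := by
  simp only [prefixProduct, suffixProduct, Nat.sub_sub_self hi]
  induction i with
  | zero => simp
  | succ i ih =>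
    have h1 : k - (i + 1) + 1 = k - i := by omega
    have h2 : k - (i + 1) = k - 1 - i := by omega
    rw [List.range_succ, List.map_append, List.prod_append, ih (by omega), List.range'_succ, h1]
    simp only [List.map_cons, List.map_nil, List.prod_cons, List.prod_nil, mul_one,
      Language.reverse_mul, reverse_singleton, h1]
    rw [h2]
    rfl

lemma markedProduct_eq_prefixProduct_mul (L : ℕ → Language A) (a : ℕ → A) (k : ℕ) :
    markedProduct L a k = prefixProduct L a k * L k := by
  induction k with
  | zero => simp [markedProduct, prefixProduct]
  | succ k ih =>
    have h1 : markedProduct L a (k + 1) =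
        markedProduct L a k * (({[a k]} : Language A) * L (k + 1)) := by
      simp [markedProduct, List.range_succ, mul_assoc]
    have h2 : prefixProduct L a (k + 1) =
        prefixProduct L a k * (L k * ({[a k]} : Language A)) := by
      simp [prefixProduct, List.range_succ]
    rw [h1, h2, ih]
    simp only [mul_assoc]

lemma markedProduct_rev (L : ℕ → Language A) (a : ℕ → A) (k : ℕ) :
    markedProduct (revFactors k L) (revLetters k a) k = (markedProduct L a k).reverse := by
  rw [markedProduct_eq_prefixProduct_mul, prefixProduct_rev L a le_rfl]
  have : markedProduct L a k = L 0 * suffixProduct L a k (k - k) := by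
    rw [Nat.sub_self, suffixProduct, markedProduct, List.range_eq_range', Nat.sub_zero]
  rw [this, Language.reverse_mul]
  simp [revFactors]

/-- The suffixes of `u` in a suffix product are the mirror images of the prefixes of the mirror
image of `u` in a prefix product. -/
lemma isDet_rev_iff {L : ℕ → Language A} {a : ℕ → A} {k : ℕ} :
    IsDet (revFactors k L) (revLetters k a) k ↔ IsCodet L a k := by
  have key : ∀ i ≤ k, ∀ u : List A,
      (∃! p : List A, p <+: u.reverse ∧
        p ∈ prefixProduct (revFactors k L) (revLetters k a) (k - i)) ↔
      ∃! s : List A, s <:+ u ∧ s ∈ suffixProduct L a k i := by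
    intro i hi u
    rw [prefixProduct_rev L a (Nat.sub_le k i), Nat.sub_sub_self hi,
      List.reverse_involutive.bijective.existsUnique_iff]
    simp only [List.reverse_prefix, Language.reverse_mem_reverse]
  rw [IsDet, markedProduct_rev]
  constructor
  · intro h i hi u hu
    exact (key i hi u).1 (h (k - i) (Nat.sub_le _ _) _ (Language.reverse_mem_reverse.2 hu))
  · intro h i hi u hu
    have := (key (k - i) (Nat.sub_le _ _) u.reverse).2 (h (k - i) (Nat.sub_le _ _) _ hu)
    rwa [List.reverse_reverse, Nat.sub_sub_self hi] at this

lemma IsVCodet.isVDet_rev {L : ℕ → Language A} {a : ℕ → A} {k : ℕ} (h : IsVCodet L a k) :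
    IsVDet (revFactors k L) (revLetters k a) k := by
  intro i hi w hw
  have h1 : k - i = k - 1 - i + 1 := by omega
  have hw' : w.reverse ∈ L (k - 1 - i + 1) := h1 ▸ hw
  simpa [revLetters] using h (k - 1 - i) (by omega) _ hw'

lemma IsVDet.isVCodet_rev {L : ℕ → Language A} {a : ℕ → A} {k : ℕ} (h : IsVDet L a k) :
    IsVCodet (revFactors k L) (revLetters k a) k := by
  intro i hi w hw
  have h1 : k - (i + 1) = k - 1 - i := by omega
  have hw' : w.reverse ∈ L (k - 1 - i) := h1 ▸ hw
  simpa [revLetters] using h (k - 1 - i) (by omega) _ hw'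

lemma reverse_mem_productClosure {V V' : LanguageClass}
    {P P' : ∀ {A : Type}, (ℕ → Language A) → (ℕ → A) → ℕ → Prop}
    (hV : ∀ K ∈ V A, K.reverse ∈ V' A)
    (hP : ∀ (L : ℕ → Language A) (a : ℕ → A) (k : ℕ), P L a k →
      P' (revFactors k L) (revLetters k a) k)
    {L : Language A} (hL : L ∈ productClosure V P A) : L.reverse ∈ productClosure V' P' A := by
  refine reverse_mem_closure ?_ hL
  rintro K (hK | ⟨k, L, a, h1, h2, h3, rfl⟩)
  · exact .inl (hV K hK)
  · exact .inr ⟨k, revFactors k L, revLetters k a, h1, fun i _ => hV _ (h2 _ (Nat.sub_le _ _)),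
      hP L a k h3, (markedProduct_rev L a k).symm⟩

lemma vcodetClosure_subset_codetClosure (V : LanguageClass) :
    vcodetClosure V A ⊆ codetClosure V A := by
  refine BooleanSubalgebra.closure_mono (Set.union_subset_union_right _ ?_)
  rintro K ⟨k, L, a, h1, h2, h3, h4⟩
  exact ⟨k, L, a, h1, h2, isDet_rev_iff.1 h3.isVDet_rev.isDet, h4⟩

theorem langL_succ_subset_vcodetClosure [Finite A] {m : ℕ} (hm : 1 ≤ m) :
    langL (m + 1) A ⊆ vcodetClosure (langR m) A := by
  intro L hL
  have := reverse_mem_productClosure (V := langL m) (V' := langR m) (P := IsVDet) (P' := IsVCodet)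
    (fun K hK => reverse_mem_langR_iff.2 hK) (fun _ _ _ h => h.isVCodet_rev)
    (langR_succ_subset_vdetClosure hm (reverse_mem_langR_iff.2 hL))
  rwa [Language.reverse_reverse] at this

theorem codetClosure_subset_langL_succ [Finite A] (m : ℕ) :
    codetClosure (langR m) A ⊆ langL (m + 1) A := by
  intro L hL
  exact reverse_mem_langR_iff.1 (detClosure_subset_langR_succ m
    (reverse_mem_productClosure (V := langR m) (V' := langL m) (P := IsCodet) (P' := IsDet)
      (fun K hK => reverse_mem_langL_iff.2 hK) (fun _ _ _ h => isDet_rev_iff.2 h) hL))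

end RankerHierarchy
theorem mainTheorem3 :
    (∀ m : ℕ, 1 ≤ m →
      (∀ (A : Type) [Finite A],
        RankerHierarchy.langR (m + 1) A =
          RankerHierarchy.vdetClosure (RankerHierarchy.langL m) A ∧
        RankerHierarchy.vdetClosure (RankerHierarchy.langL m) A =
          RankerHierarchy.detClosure (RankerHierarchy.langL m) A) ∧
      (∀ (M : Type) [Monoid M],
        RankerHierarchy.pvR (m + 1) M ↔
          RankerHierarchy.malcev RankerHierarchy.pvK (RankerHierarchy.pvL m) M) ∧
      (∀ (A : Type) [Finite A],
        RankerHierarchy.langL (m + 1) A =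
          RankerHierarchy.vcodetClosure (RankerHierarchy.langR m) A ∧
        RankerHierarchy.vcodetClosure (RankerHierarchy.langR m) A =
          RankerHierarchy.codetClosure (RankerHierarchy.langR m) A) ∧
      (∀ (M : Type) [Monoid M],
        RankerHierarchy.pvL (m + 1) M ↔
          RankerHierarchy.malcev RankerHierarchy.pvD (RankerHierarchy.pvR m) M)) ∧
    (∀ (M : Type) [Monoid M],
      RankerHierarchy.pvR 2 M ↔ RankerHierarchy.pvRTrivial M) ∧
    (∀ (M : Type) [Monoid M],
      RankerHierarchy.pvL 2 M ↔ RankerHierarchy.pvLTrivial M) := by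
  refine ⟨fun m hm => ⟨fun A _ => ?_, fun M _ => RankerHierarchy.pvR_succ_iff hm M, fun A _ => ?_,
    fun M _ => RankerHierarchy.pvL_succ_iff hm M⟩, fun M _ => RankerHierarchy.pvR_two_iff M,
    fun M _ => RankerHierarchy.pvL_two_iff M⟩
  · have h1 := RankerHierarchy.langR_succ_subset_vdetClosure (A := A) hm
    have h2 := RankerHierarchy.vdetClosure_subset_detClosure (A := A) (RankerHierarchy.langL m)
    have h3 := RankerHierarchy.detClosure_subset_langR_succ (A := A) m
    exact ⟨h1.antisymm (h2.trans h3), h2.antisymm (h3.trans h1)⟩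
  · have h1 := RankerHierarchy.langL_succ_subset_vcodetClosure (A := A) hm
    have h2 := RankerHierarchy.vcodetClosure_subset_codetClosure (A := A) (RankerHierarchy.langR m)
    have h3 := RankerHierarchy.codetClosure_subset_langL_succ (A := A) m
    exact ⟨h1.antisymm (h2.trans h3), h2.antisymm (h3.trans h1)⟩
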